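/- **Theorem 1.1.** Notation. For a meromorphic function $g$ on $\mathbb{C}$ let $T(r,g)$ be its Nevanlinna characteristic and $n(r,g)$ the number of its poles in $|z|\le r$, counted with multiplicity. With the convention $\log 0=-\infty$, define, in $[-\infty,+\infty]$, $$\rho_{\log}(g)=\limsup_{r\to\infty}\frac{\log T(r,g)}{\log\log r},\qquad \mu_{\log}(g)=\liminf_{r\to\infty}\frac{\log T(r,g)}{\log\log r},\qquad \lambda_{\log}\Big(\frac1g\Big)=\limsup_{r\to\infty}\frac{\log n(r,g)}{\log\log r},$$ and, when the order in the exponent is less than $+\infty$, $$\tau_{\log}(g)=\limsup_{r\to\infty}\frac{T(r,g)}{(\log r)^{\rho_{\log}(g)}},\qquad \underline{\tau}_{\log}(g)=\liminf_{r\to\infty}\frac{T(r,g)}{(\log r)^{\mu_{\log}(g)}}$$ (an exponent $-\infty$ is replaced by $0$; then $\tau_{\log}(g)=0$ if $\rho_{\log}(g)=-\infty$). Let $n,m\ge 0$ be integers, let $A_{ij}$ $(0\le i\le n,\ 0\le j\le m)$ and $F$ be meromorphic functions on $\mathbb{C}$, and let $c_0,\dots,c_n$ be distinct nonzero complex numbers.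 Let $a,l\in\{0,\dots,n\}$ and $b\in\{0,\dots,m\}$ with $(a,b)\ne(l,0)$. Put $$S=\{F\}\cup\{A_{ij}:(i,j)\ne(a,b),(l,0)\},\qquad \rho_{\log}(S)=\max\{\rho_{\log}(g):g\in S\},\qquad \Sigma=\sum_{\substack{(i,j)\ne(l,0),(a,b)\\ \rho_{\log}(A_{ij})=\mu_{\log}(A_{l0})}}\tau_{\log}(A_{ij}).$$ Suppose that $\mu_{\log}(A_{l0})>0$, that $\lambda_{\log}(1/A_{l0})+1<\mu_{\log}(A_{l0})<\infty$, and that (i) $\max\{\mu_{\log}(A_{ab}),\rho_{\log}(S)\}\le\mu_{\log}(A_{l0})$; (ii) $\underline{\tau}_{\log}(A_{l0})>\underline{\tau}_{\log}(A_{ab})$ whenever $\mu_{\log}(A_{l0})=\mu_{\log}(A_{ab})$; (iii) $\Sigma+\tau_{\log}(F)<\underline{\tau}_{\log}(A_{l0})<\infty$ whenever $\mu_{\log}(A_{l0})=\rho_{\log}(S)$; (iv) $\Sigma+\tau_{\log}(F)+\underline{\tau}_{\log}(A_{ab})<\underline{\tau}_{\log}(A_{l0})<\infty$ whenever $\mu_{\log}(A_{l0})=\mu_{\log}(A_{ab})=\rho_{\log}(S)$.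 If $F\not\equiv0$, then every meromorphic solution $f$ of $$\sum_{i=0}^{n}\sum_{j=0}^{m}A_{ij}(z)f^{(j)}(z+c_i)=F(z)$$ satisfies $\rho_{\log}(f)\ge\mu_{\log}(A_{l0})$. If $F\equiv0$, then every meromorphic solution $f\not\equiv0$ of the homogeneous equation $\sum_{i=0}^{n}\sum_{j=0}^{m}A_{ij}(z)f^{(j)}(z+c_i)=0$ satisfies $\rho_{\log}(f)\ge\mu_{\log}(A_{l0})+1$. -/

import Mathlib

namespace DelayDiff

open Filter MeromorphicOn

/-- The Nevanlinna characteristic `T(r, f) = m(r, f) + N(r, f)` of a meromorphic function. -/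
noncomputable def nevT (f : ℂ → ℂ) (r : ℝ) : ℝ :=
  ValueDistribution.characteristic f ⊤ r

/-- The unintegrated counting function `n(r, f)`: the number of poles of `f` in the closed disc
`|z| ≤ r`, counted with multiplicity. -/
noncomputable def poleCount (f : ℂ → ℂ) (r : ℝ) : ℤ :=
  ∑ᶠ z ∈ Metric.closedBall (0 : ℂ) r, (divisor f Set.univ)⁻ z

/-- The extended logarithm of a nonnegative real number, with `log 0 = -∞`. -/
noncomputable def elog (x : ℝ) : EReal :=
  ENNReal.log (ENNReal.ofReal x)

/-- The logarithmic order `ρ_log(f) = limsup log T(r, f) / log log r`. -/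
noncomputable def logOrder (f : ℂ → ℂ) : EReal :=
  limsup (fun r : ℝ => elog (nevT f r) / ((Real.log (Real.log r) : ℝ) : EReal)) atTop

/-- The logarithmic lower order `μ_log(f) = liminf log T(r, f) / log log r`. -/
noncomputable def logLowerOrder (f : ℂ → ℂ) : EReal :=
  liminf (fun r : ℝ => elog (nevT f r) / ((Real.log (Real.log r) : ℝ) : EReal)) atTop

/-- The logarithmic type `τ_log(f) = limsup T(r, f) / (log r) ^ ρ_log(f)`, for functions of finite
logarithmic order. (If `T(r, f)` vanishes for large `r`, then `ρ_log(f) = -∞` and the exponent is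
irrelevant: the type is `0`.) -/
noncomputable def logType (f : ℂ → ℂ) : EReal :=
  limsup (fun r : ℝ => ((nevT f r / Real.log r ^ (logOrder f).toReal : ℝ) : EReal)) atTop

/-- The logarithmic lower type `liminf T(r, f) / (log r) ^ μ_log(f)`, for functions of finite
logarithmic lower order. -/
noncomputable def logLowerType (f : ℂ → ℂ) : EReal :=
  liminf (fun r : ℝ => ((nevT f r / Real.log r ^ (logLowerOrder f).toReal : ℝ) : EReal)) atTop

/-- The logarithmic exponent of convergence of the poles of `f`,
`λ_log(1/f) = limsup log n(r, f) / log log r`; it is `-∞` exactly when `f` has no poles. -/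
noncomputable def logPoleExponent (f : ℂ → ℂ) : EReal :=
  limsup (fun r : ℝ =>
    elog (poleCount f r : ℝ) / ((Real.log (Real.log r) : ℝ) : EReal)) atTop

/-- Identity `f ≡ g` of meromorphic functions: equality outside a closed discrete set, so that the
values which Lean assigns at poles or removable singularities play no role. -/
def MerEq (f g : ℂ → ℂ) : Prop :=
  f =ᶠ[codiscrete ℂ] g

/-- `f` is a meromorphic solution of `∑ i, ∑ j, A i j (z) f^(j)(z + c i) = F(z)`. -/
def IsMeromorphicSolution {n m : ℕ} (A : Fin (n + 1) → Fin (m + 1) → ℂ → ℂ)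
    (c : Fin (n + 1) → ℂ) (F f : ℂ → ℂ) : Prop :=
  Meromorphic f ∧
    MerEq (fun z => ∑ i, ∑ j : Fin (m + 1), A i j z * iteratedDeriv (j : ℕ) f (z + c i)) F

/-- The set `S = {F, A i j : (i, j) ≠ (a, b), (l, 0)}`. -/
def remainingData {n m : ℕ} (A : Fin (n + 1) → Fin (m + 1) → ℂ → ℂ) (F : ℂ → ℂ)
    (l a : Fin (n + 1)) (b : Fin (m + 1)) : Set (ℂ → ℂ) :=
  insert F {g | ∃ i j, (i, j) ≠ (a, b) ∧ (i, j) ≠ (l, 0) ∧ g = A i j}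

/-- `ρ_log(S)`, the maximum of `ρ_log(g)` over `g ∈ S`. -/
noncomputable def logOrderOfSet (S : Set (ℂ → ℂ)) : EReal :=
  ⨆ g ∈ S, logOrder g

open Classical in
/-- The sum of `τ_log(A i j)` over the index pairs `(i, j) ≠ (l, 0), (a, b)` for which
`ρ_log(A i j) = μ_log(A l 0)`. -/
noncomputable def criticalTypeSum {n m : ℕ} (A : Fin (n + 1) → Fin (m + 1) → ℂ → ℂ)
    (l a : Fin (n + 1)) (b : Fin (m + 1)) : EReal :=
  ∑ p : Fin (n + 1) × Fin (m + 1) with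
    logOrder (A p.1 p.2) = logLowerOrder (A l 0) ∧ p ≠ (l, 0) ∧ p ≠ (a, b), logType (A p.1 p.2)

end DelayDiff

/-!
The idea is that a meromorphic function `f` of finite logarithmic order is almost constant near many
circles. Its number of zeros and poles in a disc of radius `4 * R` is polylogarithmic in `R`, so by
the pigeonhole principle some circle `‖z‖ = r` with `R / 2 ≤ r ≤ R` has distance at least
`R / (log R) ^ O(1)` from all of them. Dividing out the zeros and poles leaves a harmonic function
`log ‖g‖` on the disc, whose mean modulus on the boundary is polylogarithmic, so that Poisson's
formula bounds its oscillation over bounded distances by `(log R) ^ O(1) / R`. Hence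
`|log ‖f w‖ - log ‖f z‖| ≤ 1` whenever `‖z‖ = r` and `‖w - z‖ ≤ D`, for any fixed `D`
(`eventually_exists_radius_abs_log_norm_sub_le_one`). Cauchy's estimates then bound all quotients
`f^(j)(z + c i) / f(z + c l)` on that circle by a constant, and the equation, divided by
`f(z + c l)`, yields for every large `R`

`T(R / 2, A l 0) ≤ N(R, A l 0) + ∑ T(R, A i j) + T(R, F) + T(R, f) + C`,

the sum being over `(i, j) ≠ (l, 0)` (`exists_eventually_nevT_half_le`); the passage from `r` to `R`
and `R / 2` uses that the characteristic is monotone. For the homogeneous equation the terms with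
`F` and `f` are absent (`exists_eventually_nevT_half_le_of_homogeneous`).

The hypotheses provide an exponent `s` such that, in the scale `(log r) ^ s`, the coefficient `A l 0`
strictly dominates the sum of all other data along a sequence of radii
(`exists_exponent_limsup_add_liminf_lt`), while `N(r, A l 0)` is negligible by the assumption on the
poles. Only one datum, `A a b`, is controlled through a lower limit, so one sequence of radii serves
all of them. If `f` had logarithmic order less than the lower order of `A l 0`, then
`T(r, f)` would be negligible as well, and the inequality above would fail. In the homogeneous case
it fails for every `f` of finite logarithmic order, so that solutions have infinite logarithmic
order, which is more than required.
-/

namespace DelayDiff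

open Filter MeromorphicOn Metric Real ValueDistribution InnerProductSpace Set Function Topology

/-! ### Oscillation of harmonic functions -/

/-- A Lipschitz estimate for harmonic functions in the disc of half the radius, in terms of the mean
modulus on the boundary circle; it follows from Poisson's formula. -/
theorem abs_sub_le_of_harmonicOnNhd {u : ℂ → ℝ} {ρ : ℝ} (hρ : 0 < ρ)
    (hu : HarmonicOnNhd u (closedBall 0 ρ)) {z w : ℂ} (hz : ‖z‖ ≤ ρ / 2) (hw : ‖w‖ ≤ ρ / 2) :
    |u w - u z| ≤ 8 * ‖w - z‖ / ρ * circleAverage (fun ζ => |u ζ|) 0 ρ := by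
  have hcont : ContinuousOn u (sphere 0 ρ) := hu.continuousOn.mono sphere_subset_closedBall
  have hker : ∀ a : ℂ, ‖a‖ ≤ ρ / 2 → ContinuousOn (Complex.re ∘ herglotzRieszKernel 0 a)
      (sphere 0 ρ) := by
    intro a ha
    refine Complex.continuous_re.comp_continuousOn ?_
    simp only [herglotzRieszKernel_fun_def]
    refine ContinuousOn.div (by fun_prop) (by fun_prop) fun ζ hζ h0 => ?_
    have : ‖ζ‖ = ρ := by simpa using hζ
    have h1 : ζ = a := by simpa [sub_eq_zero] using h0
    rw [h1] at this
    linarith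
  have hint : ∀ a : ℂ, ‖a‖ ≤ ρ / 2 →
      CircleIntegrable ((Complex.re ∘ herglotzRieszKernel 0 a) • u) 0 ρ := fun a ha =>
    ((hker a ha).smul hcont).circleIntegrable hρ.le
  have hrep : ∀ a : ℂ, ‖a‖ ≤ ρ / 2 →
      circleAverage ((Complex.re ∘ herglotzRieszKernel 0 a) • u) 0 ρ = u a := fun a ha =>
    HarmonicOnNhd.circleAverage_re_herglotzRieszKernel_smul hu (by simp; linarith)
  rw [← hrep w hw, ← hrep z hz, ← circleAverage_sub (hint w hw) (hint z hz)]
  refine abs_circleAverage_le_circleAverage_abs.trans ?_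
  rw [← smul_eq_mul, ← circleAverage_fun_smul]
  refine circleAverage_mono ((hint w hw).sub (hint z hz)).abs ?_ fun ζ hζ => ?_
  · exact (hcont.abs.const_smul (8 * ‖w - z‖ / ρ)).circleIntegrable hρ.le
  have hζρ : ‖ζ‖ = ρ := by simpa [abs_of_pos hρ] using hζ
  have hd : ∀ a : ℂ, ‖a‖ ≤ ρ / 2 → ρ / 2 ≤ ‖ζ - a‖ := fun a ha => by
    have := norm_sub_norm_le ζ a
    linarith
  have hne : ∀ a : ℂ, ‖a‖ ≤ ρ / 2 → ζ - a ≠ 0 := fun a ha h0 => by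
    have := hd a ha
    rw [h0, norm_zero] at this
    linarith
  simp only [Pi.abs_apply, Pi.sub_apply, smul_eq_mul, Pi.mul_apply, comp_apply]
  rw [← sub_mul, abs_mul]
  refine mul_le_mul_of_nonneg_right ?_ (abs_nonneg _)
  rw [← Complex.sub_re]
  refine (Complex.abs_re_le_norm _).trans ?_
  have hker2 : herglotzRieszKernel 0 w ζ - herglotzRieszKernel 0 z ζ
      = 2 * ζ * (w - z) / ((ζ - w) * (ζ - z)) := by
    have h1 := hne w hw
    have h2 := hne z hz
    simp only [herglotzRieszKernel_def, sub_zero]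
    field_simp
    ring
  rw [hker2, norm_div, norm_mul, norm_mul, norm_mul, hζρ, Complex.norm_ofNat]
  have h1 := hd w hw
  have h2 := hd z hz
  have h3 : ρ / 2 * (ρ / 2) ≤ ‖ζ - w‖ * ‖ζ - z‖ := by gcongr
  rw [div_le_div_iff₀ (by nlinarith) hρ]
  nlinarith [norm_nonneg (w - z), mul_le_mul_of_nonneg_left h3 (norm_nonneg (w - z))]

/-! ### Counting functions -/

/-- Jensen-type comparison of the number of points in a disc with the integrated counting
function of twice the radius. -/
theorem sum_mul_log_two_le_logCounting {D : locallyFinsupp ℂ ℤ} (hD : 0 ≤ D) {r : ℝ}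
    (hr : 1 ≤ r) (s : Finset ℂ) (hs : ∀ z ∈ s, ‖z‖ ≤ r) :
    (∑ z ∈ s, (D z : ℝ)) * log 2 ≤ locallyFinsuppWithin.logCounting D (2 * r) := by
  classical
  have hr0 : 0 < r := by linarith
  have habs : |2 * r| = 2 * r := abs_of_pos (by linarith)
  have hfin : (D.toClosedBall (2 * r)).support.Finite :=
    locallyFinsuppWithin.finiteSupport _ (isCompact_closedBall _ _)
  have hDnn : ∀ z, (0 : ℝ) ≤ D z := fun z => by exact_mod_cast hD z
  set t := s ∪ hfin.toFinset with ht
  have hsum : ∑ᶠ z, (D.toClosedBall (2 * r) z : ℝ) * log (2 * r * ‖z‖⁻¹)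
      = ∑ z ∈ t, (D.toClosedBall (2 * r) z : ℝ) * log (2 * r * ‖z‖⁻¹) := by
    refine finsum_eq_sum_of_support_subset _ fun z hz => ?_
    have : D.toClosedBall (2 * r) z ≠ 0 := by
      intro h0
      simp [h0] at hz
    simp [ht, this]
  have hlog : ∀ z : ℂ, ‖z‖ ≤ 2 * r → 0 ≤ log (2 * r * ‖z‖⁻¹) := fun z hz => by
    rcases eq_or_ne z 0 with rfl | h0
    · simp
    · have : 0 < ‖z‖ := norm_pos_iff.2 h0
      refine log_nonneg ?_
      rw [← div_eq_mul_inv, le_div_iff₀ this]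
      linarith
  have hterm : ∀ z, 0 ≤ (D.toClosedBall (2 * r) z : ℝ) * log (2 * r * ‖z‖⁻¹) := fun z => by
    by_cases hz : z ∈ closedBall (0 : ℂ) |2 * r|
    · rw [locallyFinsuppWithin.toClosedBall_eval_within _ hz]
      refine mul_nonneg (hDnn z) (hlog z ?_)
      simpa [habs] using hz
    · rw [(D.toClosedBall (2 * r)).apply_eq_zero_of_notMem hz]
      simp
  change _ ≤ ∑ᶠ z, (D.toClosedBall (2 * r) z : ℝ) * log (2 * r * ‖z‖⁻¹) + (D 0) * log (2 * r)
  rw [hsum]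
  have hsub : ∑ z ∈ s, (D.toClosedBall (2 * r) z : ℝ) * log (2 * r * ‖z‖⁻¹)
      ≤ ∑ z ∈ t, (D.toClosedBall (2 * r) z : ℝ) * log (2 * r * ‖z‖⁻¹) :=
    Finset.sum_le_sum_of_subset_of_nonneg Finset.subset_union_left fun z _ _ => hterm z
  have hl2 : log 2 ≤ log (2 * r) := log_le_log (by norm_num) (by linarith)
  have hl2' : 0 < log 2 := log_pos (by norm_num)
  have hpt : ∀ z ∈ s, (D z : ℝ) * log 2 ≤ (D.toClosedBall (2 * r) z : ℝ) * log (2 * r * ‖z‖⁻¹)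
      + if z = 0 then (D 0 : ℝ) * log (2 * r) else 0 := fun z hz => by
    split_ifs with h0
    · subst h0
      have := hterm 0
      have := mul_le_mul_of_nonneg_left hl2 (hDnn 0)
      linarith
    · have hz1 := hs z hz
      have hzpos : 0 < ‖z‖ := norm_pos_iff.2 h0
      rw [locallyFinsuppWithin.toClosedBall_eval_within _ (by simp [habs]; linarith), add_zero]
      refine mul_le_mul_of_nonneg_left (log_le_log (by norm_num) ?_) (hDnn z)
      rw [← div_eq_mul_inv, le_div_iff₀ hzpos]
      nlinarith
  have hite : ∑ z ∈ s, (if z = 0 then (D 0 : ℝ) * log (2 * r) else 0) ≤ (D 0) * log (2 * r) := by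
    rw [Finset.sum_ite_eq']
    have := mul_nonneg (hDnn 0) (hl2'.le.trans hl2)
    split_ifs <;> simp [this]
  have := Finset.sum_le_sum hpt
  rw [Finset.sum_add_distrib, ← Finset.sum_mul] at this
  linarith

/-- The number of points in a disc times `log r` bounds the integrated counting function, up to
a constant which accounts for the points of the unit disc. -/
theorem exists_logCounting_le_mul_log {D : locallyFinsupp ℂ ℤ} (hD : 0 ≤ D) :
    ∃ C, ∀ r, 1 ≤ r → locallyFinsuppWithin.logCounting D r
      ≤ ((∑ᶠ z ∈ closedBall (0 : ℂ) r, D z : ℤ) : ℝ) * log r + C := by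
  classical
  have hfin : ∀ r, (D.toClosedBall r).support.Finite := fun r =>
    locallyFinsuppWithin.finiteSupport _ (isCompact_closedBall _ _)
  have hDnn : ∀ z, (0 : ℝ) ≤ D z := fun z => by exact_mod_cast hD z
  set s₁ := (hfin 1).toFinset with hs₁
  refine ⟨∑ z ∈ s₁, (D z : ℝ) * |log ‖z‖|, fun r hr => ?_⟩
  have hr0 : 0 < r := by linarith
  set s := (hfin r).toFinset with hs
  have hmem : ∀ t, 1 ≤ t → ∀ z, z ∈ (hfin t).toFinset ↔ ‖z‖ ≤ t ∧ D z ≠ 0 := fun t ht z => by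
    have habs : |t| = t := abs_of_pos (by linarith)
    simp only [Finite.mem_toFinset, Function.mem_support]
    by_cases hz : z ∈ closedBall (0 : ℂ) |t|
    · rw [locallyFinsuppWithin.toClosedBall_eval_within _ hz]
      simp [habs] at hz
      simp [hz]
    · rw [(D.toClosedBall t).apply_eq_zero_of_notMem hz]
      simp [habs] at hz
      simp [hz]
  have hcount : ∑ᶠ z ∈ closedBall (0 : ℂ) r, D z = ∑ z ∈ s, D z := by
    refine finsum_mem_eq_sum_of_inter_support_eq _ ?_
    ext z
    have := hmem r hr z
    simp only [hs, mem_inter_iff, mem_closedBall, dist_zero_right, Function.mem_support,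
      Finset.mem_coe, this]
    tauto
  change ∑ᶠ z, (D.toClosedBall r z : ℝ) * log (r * ‖z‖⁻¹) + (D 0) * log r ≤ _
  have hsum : ∑ᶠ z, (D.toClosedBall r z : ℝ) * log (r * ‖z‖⁻¹)
      = ∑ z ∈ s, (D.toClosedBall r z : ℝ) * log (r * ‖z‖⁻¹) := by
    refine finsum_eq_sum_of_support_subset _ fun z hz => ?_
    have : D.toClosedBall r z ≠ 0 := by
      intro h0
      simp [h0] at hz
    simp [hs, this]
  rw [hsum, hcount]
  have hlr : 0 ≤ log r := log_nonneg hr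
  have h0s : (D 0 : ℝ) * log r = ∑ z ∈ s, if z = 0 then (D 0 : ℝ) * log r else 0 := by
    rw [Finset.sum_ite_eq']
    split_ifs with h
    · rfl
    · rw [hmem r hr] at h
      simp [hr0.le] at h
      simp [h]
  rw [h0s, ← Finset.sum_add_distrib]
  push_cast
  rw [Finset.sum_mul]
  have hs₁s : s₁ ⊆ s := fun z hz => by
    rw [hs₁, hmem 1 le_rfl] at hz
    rw [hs, hmem r hr]
    exact ⟨hz.1.trans hr, hz.2⟩
  have hC : ∑ z ∈ s₁, (D z : ℝ) * |log ‖z‖| = ∑ z ∈ s, if z ∈ s₁ then (D z : ℝ) * |log ‖z‖| else 0 := by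
    rw [← Finset.sum_filter, Finset.filter_mem_eq_inter, Finset.inter_eq_right.2 hs₁s]
  rw [hC, ← Finset.sum_add_distrib]
  refine Finset.sum_le_sum fun z hz => ?_
  rw [hs, hmem r hr] at hz
  rw [locallyFinsuppWithin.toClosedBall_eval_within _ (by simpa [abs_of_pos hr0] using hz.1)]
  split_ifs with h0 h1 h1
  · subst h0; simp
  · subst h0; simp
  · have hzpos : 0 < ‖z‖ := norm_pos_iff.2 h0
    rw [log_mul hr0.ne' (by positivity), log_inv]
    have := mul_le_mul_of_nonneg_left (neg_le_abs (log ‖z‖)) (hDnn z)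
    linarith
  · have hzpos : 0 < ‖z‖ := norm_pos_iff.2 h0
    rw [log_mul hr0.ne' (by positivity), log_inv]
    have h1z : 1 ≤ ‖z‖ := by
      rw [hs₁, hmem 1 le_rfl] at h1
      by_contra h
      exact h1 ⟨(not_le.1 h).le, hz.2⟩
    have := mul_nonneg (hDnn z) (log_nonneg h1z)
    linarith

/-! ### Radii away from finitely many points -/

/-- Finitely many intervals of total length less than `b - a` do not cover `[a, b]`. -/
theorem exists_mem_Icc_forall_le_abs_sub (s : Finset ℝ) {a b δ : ℝ} (hδ : 0 ≤ δ)
    (h : s.card * (2 * δ) < b - a) : ∃ r ∈ Icc a b, ∀ x ∈ s, δ ≤ |r - x| := by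
  by_contra! hcon
  have hsub : Icc a b ⊆ ⋃ x ∈ s, ball x δ := fun r hr => by
    obtain ⟨x, hx, hlt⟩ := hcon r hr
    simp only [mem_iUnion, mem_ball, Real.dist_eq]
    exact ⟨x, hx, hlt⟩
  have h1 := (MeasureTheory.measure_mono (μ := MeasureTheory.volume) hsub).trans
    (MeasureTheory.measure_biUnion_finset_le s _)
  simp only [Real.volume_Icc, Real.volume_ball, Finset.sum_const, nsmul_eq_mul] at h1
  rw [← ENNReal.ofReal_natCast, ← ENNReal.ofReal_mul (by positivity),
    ENNReal.ofReal_le_ofReal_iff (by positivity)] at h1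
  linarith

/-! ### Factoring out zeros and poles -/

theorem circleAverage_abs_log_norm_sub_le {ρ : ℝ} (hρ : 1 ≤ ρ) {u : ℂ} (hu : ‖u‖ ≤ ρ) :
    circleAverage (fun z => |log ‖z - u‖|) 0 ρ ≤ 2 * log (2 * ρ) := by
  have hρ0 : 0 < ρ := by linarith
  have hint : CircleIntegrable (fun z => log ‖z - u‖) 0 ρ := circleIntegrable_log_norm_sub_const ρ
  have havg : circleAverage (fun z => log ‖z - u‖) 0 ρ = log ρ :=
    circleAverage_log_norm_sub_const_of_mem_closedBall (by simpa [abs_of_pos hρ0] using hu)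
  have hl : 0 ≤ log (2 * ρ) := log_nonneg (by linarith)
  calc circleAverage (fun z => |log ‖z - u‖|) 0 ρ
      ≤ circleAverage (fun z => 2 * log (2 * ρ) - log ‖z - u‖) 0 ρ := by
        refine circleAverage_mono hint.abs ((circleIntegrable_const _ _ _).sub hint) fun z hz => ?_
        have hz' : ‖z‖ = ρ := by simpa [abs_of_pos hρ0] using hz
        have h1 : log ‖z - u‖ ≤ log (2 * ρ) := by
          rcases eq_or_ne (z - u) 0 with h0 | h0
          · simpa [h0] using hl
          · refine log_le_log (norm_pos_iff.2 h0) ((norm_sub_le _ _).trans ?_)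
            linarith
        rw [abs_le]
        constructor <;> linarith
    _ = 2 * log (2 * ρ) - log ρ := by
        rw [circleAverage_fun_sub (circleIntegrable_const _ _ _) hint, circleAverage_const, havg]
    _ ≤ _ := by linarith [log_nonneg hρ]

/-- On a disc, `log ‖f‖` is the sum of the logarithmic potentials of the zeros and poles of `f` and
of a function `log ‖g‖` with `g` analytic and zero-free, whose mean modulus on the boundary circle
is controlled. The finite set `s` consists of the zeros and poles in the closed disc. -/
theorem exists_log_norm_eq_sum_add_log_norm {f : ℂ → ℂ} (hf : MeromorphicNFOn f univ)
    (hf0 : ∀ z, meromorphicOrderAt f z ≠ ⊤) {ρ : ℝ} (hρ : 1 ≤ ρ) :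
    ∃ (s : Finset ℂ) (g : ℂ → ℂ), (∀ u ∈ s, ‖u‖ ≤ ρ ∧ divisor f univ u ≠ 0) ∧
      (∀ z, ‖z‖ < ρ → z ∉ s → AnalyticAt ℂ f z ∧ f z ≠ 0 ∧
        log ‖f z‖ = ∑ u ∈ s, (divisor f univ u : ℝ) * log ‖z - u‖ + log ‖g z‖) ∧
      AnalyticOnNhd ℂ g (closedBall 0 ρ) ∧ (∀ z ∈ closedBall 0 ρ, g z ≠ 0) ∧
      circleAverage (fun z => |log ‖g z‖|) 0 ρ ≤ circleAverage (fun z => |log ‖f z‖|) 0 ρ +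
        (∑ u ∈ s, |(divisor f univ u : ℝ)|) * (2 * log (2 * ρ)) := by
  classical
  have hρ0 : 0 < ρ := by linarith
  have hfu : MeromorphicOn f univ := hf.meromorphicOn
  have hfm : MeromorphicOn f (closedBall 0 ρ) := hfu.mono_set (subset_univ _)
  have hfin : (divisor f (closedBall 0 ρ)).support.Finite :=
    locallyFinsuppWithin.finiteSupport _ (isCompact_closedBall _ _)
  obtain ⟨g, hg, hg0, hfg⟩ := hfm.extract_zeros_poles (fun u => hf0 u) hfin
  have hlog := extract_zeros_poles_log hg0 hfg
  have hdiv : ∀ z ∈ closedBall (0 : ℂ) ρ, divisor f (closedBall 0 ρ) z = divisor f univ z :=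
    fun z hz => by rw [hfm.divisor_apply hz, hfu.divisor_apply (mem_univ z)]
  set s := hfin.toFinset with hs
  have hsmem : ∀ z ∈ s, z ∈ closedBall (0 : ℂ) ρ := fun z hz =>
    (divisor f (closedBall 0 ρ)).supportWithinDomain (by simpa [hs] using hz)
  have hsum : (∑ᶠ u, fun x => (divisor f (closedBall 0 ρ) u : ℝ) * log ‖x - u‖)
      = fun x => ∑ u ∈ s, (divisor f univ u : ℝ) * log ‖x - u‖ := by
    rw [finsum_eq_sum_of_support_subset (s := s)]
    · ext x
      simp only [Finset.sum_apply]
      exact Finset.sum_congr rfl fun u hu => by rw [hdiv u (hsmem u hu)]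
    · intro u hu
      simp only [hs, Finite.coe_toFinset, Function.mem_support]
      intro h0
      exact hu (by ext x; simp [h0])
  rw [hsum] at hlog
  refine ⟨s, g, fun u hu => ⟨by simpa using hsmem u hu, ?_⟩, fun z hz hzs => ?_, hg,
    fun z hz => hg0 ⟨z, hz⟩, ?_⟩
  · rw [← hdiv u (hsmem u hu)]
    simpa [hs] using hu
  · have hzb : z ∈ closedBall (0 : ℂ) ρ := by simpa using hz.le
    have hd0 : divisor f (closedBall 0 ρ) z = 0 := by simpa [hs] using hzs
    rw [hfm.divisor_apply hzb, WithTop.untop₀_eq_zero] at hd0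
    have hord := hd0.resolve_right (hf0 z)
    have hNF := hf (mem_univ z)
    have hfa : AnalyticAt ℂ f z := hNF.meromorphicOrderAt_nonneg_iff_analyticAt.1 hord.ge
    have hfz : f z ≠ 0 := hNF.meromorphicOrderAt_eq_zero_iff.1 hord
    refine ⟨hfa, hfz, ?_⟩
    have hev : ∀ᶠ x in 𝓝[≠] z, log ‖f x‖
        = ∑ u ∈ s, (divisor f univ u : ℝ) * log ‖x - u‖ + log ‖g x‖ := by
      have h1 := mem_codiscreteWithin.1 hlog z hzb
      rw [disjoint_principal_right] at h1
      have h2 : closedBall (0 : ℂ) ρ ∈ 𝓝[≠] z :=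
        mem_nhdsWithin_of_mem_nhds (closedBall_mem_nhds_of_mem (by simpa using hz))
      filter_upwards [h1, h2] with x hx1 hx2
      by_contra hne
      exact hx1 ⟨hx2, hne⟩
    have hcf : ContinuousAt (fun x => log ‖f x‖) z :=
      hfa.continuousAt.norm.log (norm_ne_zero_iff.2 hfz)
    have hcg : ContinuousAt (fun x => ∑ u ∈ s, (divisor f univ u : ℝ) * log ‖x - u‖ + log ‖g x‖) z := by
      refine ContinuousAt.add ?_ ((hg z hzb).continuousAt.norm.log
        (norm_ne_zero_iff.2 (hg0 ⟨z, hzb⟩)))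
      refine tendsto_finsetSum _ fun u hu => ?_
      refine ContinuousAt.mul continuousAt_const (ContinuousAt.log (by fun_prop) ?_)
      rw [norm_ne_zero_iff, sub_ne_zero]
      rintro rfl
      exact hzs hu
    exact tendsto_nhds_unique (hcf.mono_left nhdsWithin_le_nhds)
      ((hcg.mono_left nhdsWithin_le_nhds).congr' (hev.mono fun _ h => h.symm))
  · have hsph : sphere (0 : ℂ) |ρ| ⊆ closedBall 0 ρ := by
      rw [abs_of_pos hρ0]; exact sphere_subset_closedBall
    have hlog' := hlog.filter_mono (codiscreteWithin_mono hsph)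
    have hif : CircleIntegrable (fun z => log ‖f z‖) 0 ρ :=
      circleIntegrable_log_norm (hfm.mono_set hsph)
    have hifa : CircleIntegrable (fun z => |log ‖f z‖|) 0 ρ := hif.abs
    have hiu : ∀ u, CircleIntegrable (fun z => log ‖z - u‖) 0 ρ := fun u =>
      circleIntegrable_log_norm_sub_const ρ
    have hig : CircleIntegrable (fun z => |log ‖f z‖
        - ∑ u ∈ s, (divisor f univ u : ℝ) * log ‖z - u‖|) 0 ρ := by
      refine (hif.sub (CircleIntegrable.fun_sum s (f := fun u z => (divisor f univ u : ℝ) * log ‖z - u‖)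
        fun u _ => ?_)).abs
      exact (hiu u).const_smul (a := (divisor f univ u : ℝ))
    have hi2 : ∀ u, CircleIntegrable (fun z => |(divisor f univ u : ℝ)| * |log ‖z - u‖|) 0 ρ :=
      fun u => (hiu u).abs.const_smul (a := |(divisor f univ u : ℝ)|)
    have heq : circleAverage (fun z => |log ‖g z‖|) 0 ρ = circleAverage (fun z => |log ‖f z‖
        - ∑ u ∈ s, (divisor f univ u : ℝ) * log ‖z - u‖|) 0 ρ := by
      refine circleAverage_congr_codiscreteWithin ?_ hρ0.ne'
      filter_upwards [hlog'] with z hz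
      rw [hz, Pi.add_apply, add_sub_cancel_left]
    rw [heq]
    calc _ ≤ circleAverage (fun z => |log ‖f z‖|
          + ∑ u ∈ s, |(divisor f univ u : ℝ)| * |log ‖z - u‖|) 0 ρ := by
          refine circleAverage_mono hig (hif.abs.add (CircleIntegrable.fun_sum s fun u _ => hi2 u))
            fun z _ => (abs_sub _ _).trans ?_
          refine add_le_add le_rfl ((Finset.abs_sum_le_sum_abs _ _).trans_eq ?_)
          simp only [abs_mul]
      _ = circleAverage (fun z => |log ‖f z‖|) 0 ρ
          + ∑ u ∈ s, |(divisor f univ u : ℝ)| * circleAverage (fun z => |log ‖z - u‖|) 0 ρ := by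
          rw [circleAverage_fun_add hifa (CircleIntegrable.fun_sum s fun u _ => hi2 u),
            circleAverage_fun_sum fun u _ => hi2 u]
          refine congrArg₂ _ rfl (Finset.sum_congr rfl fun u _ => ?_)
          exact circleAverage_fun_smul (a := |(divisor f univ u : ℝ)|)
      _ ≤ _ := by
          rw [Finset.sum_mul]
          gcongr with u hu
          exact circleAverage_abs_log_norm_sub_le hρ (by simpa using hsmem u hu)

/-! ### Circles on which a slowly growing function barely oscillates -/

theorem abs_log_sub_log_le {a b m D : ℝ} (hm : 0 < m) (ha : m ≤ a) (hb : m ≤ b)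
    (h : |a - b| ≤ D) : |log a - log b| ≤ D / m := by
  have key : ∀ x y : ℝ, m ≤ x → m ≤ y → |x - y| ≤ D → log x - log y ≤ D / m := by
    intro x y hx hy hxy
    have hx0 := hm.trans_le hx
    have hy0 := hm.trans_le hy
    have hD : 0 ≤ D := (abs_nonneg _).trans hxy
    rw [← log_div hx0.ne' hy0.ne']
    calc log (x / y) ≤ x / y - 1 := log_le_sub_one_of_pos (by positivity)
      _ = (x - y) / y := by field_simp
      _ ≤ D / y := by gcongr; exact (le_abs_self _).trans hxy
      _ ≤ D / m := by gcongr
  rw [abs_le]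
  constructor
  · have := key b a hb ha (by rwa [abs_sub_comm])
    linarith
  · exact key a b ha hb h

/-- If `f` has few zeros and poles in the disc of radius `4 * R`, and `log ‖f‖` is small in mean on
its boundary, both compared to `R`, then some circle of radius between `R / 2` and `R` has a wide
neighbourhood without zeros and poles, and `log ‖f‖` is almost constant near each of its points. -/
theorem exists_radius_abs_log_norm_sub_le_one {f : ℂ → ℂ} (hf : MeromorphicNFOn f univ)
    (hf0 : ∀ z, meromorphicOrderAt f z ≠ ⊤) {R q D : ℝ} (hR : 1 ≤ R) (hD : 0 ≤ D)
    (hq : ∀ s : Finset ℂ, (∀ u ∈ s, ‖u‖ ≤ 4 * R) → ∑ u ∈ s, |(divisor f univ u : ℝ)| ≤ q)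
    (hmean : circleAverage (fun z => |log ‖f z‖|) 0 (4 * R) ≤ q)
    (hbig : 64 * (D + 1) * (q + 1) ^ 2 * (1 + log (8 * R)) ≤ R) :
    ∃ r ∈ Icc (R / 2) R, ∀ z : ℂ, ‖z‖ = r → ∀ w, ‖w - z‖ ≤ D →
      AnalyticAt ℂ f w ∧ f w ≠ 0 ∧ |log ‖f w‖ - log ‖f z‖| ≤ 1 := by
  classical
  obtain ⟨s, g, hs, hlog, hg, hg0, hgavg⟩ := exists_log_norm_eq_sum_add_log_norm hf hf0
    (ρ := 4 * R) (by linarith)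
  set n := ∑ u ∈ s, |(divisor f univ u : ℝ)| with hn
  have hnq : n ≤ q := hq s fun u hu => (hs u hu).1
  have hn0 : 0 ≤ n := Finset.sum_nonneg fun _ _ => abs_nonneg _
  have hq0 : 0 ≤ q := hn0.trans hnq
  have hcard : (s.card : ℝ) ≤ n := by
    rw [hn, Finset.card_eq_sum_ones]
    push_cast
    refine Finset.sum_le_sum fun u hu => ?_
    exact_mod_cast Int.one_le_abs (hs u hu).2
  have hl : 0 ≤ log (8 * R) := log_nonneg (by linarith)
  have hA : 64 * (D + 1) * (q + 1) ^ 2 ≤ R := by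
    refine le_trans ?_ hbig
    exact le_mul_of_one_le_right (by positivity) (by linarith)
  have hA1 : 64 * (D + 1) * (q + 1) ≤ R := by
    refine le_trans ?_ hA
    gcongr
    nlinarith
  -- `n ≤ q` intervals of length `2 * δ` have total length less than `R / 2`
  set δ := R / (8 * (q + 1)) with hδ
  have hδ0 : 0 < δ := by positivity
  have hδD : 8 * (D + 1) ≤ δ := by
    rw [hδ, le_div_iff₀ (by positivity)]
    linarith
  obtain ⟨r, hr, hrs⟩ := exists_mem_Icc_forall_le_abs_sub (s.image norm) (a := R / 2) (b := R)
    hδ0.le (by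
      have h1 : ((s.image norm).card : ℝ) ≤ q :=
        (Nat.cast_le.2 Finset.card_image_le).trans (hcard.trans hnq)
      have h2 : q * (2 * δ) < R - R / 2 := by
        have : q * (2 * δ) = (q / (q + 1)) * (R / 4) := by rw [hδ]; field_simp; ring
        rw [this]
        have h3 : q / (q + 1) ≤ 1 := by rw [div_le_one (by positivity)]; linarith
        nlinarith
      exact (mul_le_mul_of_nonneg_right h1 (by positivity)).trans_lt h2)
  have hrs' : ∀ u ∈ s, δ ≤ |r - ‖u‖| := fun u hu => hrs _ (Finset.mem_image_of_mem _ hu)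
  refine ⟨r, hr, fun z hz => ?_⟩
  have hfar : ∀ w, ‖w - z‖ ≤ D → ∀ u ∈ s, δ / 2 ≤ ‖w - u‖ := fun w hw u hu => by
    have h1 := hrs' u hu
    rw [← hz] at h1
    have h2 := h1.trans (abs_norm_sub_norm_le z u)
    have h3 : ‖z - u‖ ≤ ‖z - w‖ + ‖w - u‖ := norm_sub_le_norm_sub_add_norm_sub _ _ _
    rw [norm_sub_rev z w] at h3
    linarith
  have hnot : ∀ w, ‖w - z‖ ≤ D → w ∉ s := fun w hw hws => by
    have := hfar w hw w hws
    rw [sub_self, norm_zero] at this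
    linarith
  have hDR : D ≤ R := by nlinarith
  have hnorm : ∀ w, ‖w - z‖ ≤ D → ‖w‖ ≤ 4 * R / 2 := fun w hw => by
    have : ‖w‖ ≤ ‖w - z‖ + ‖z‖ := by simpa using norm_add_le (w - z) z
    rw [hz] at this
    linarith [hr.2]
  have hzz : ‖z - z‖ ≤ D := by simpa using hD
  intro w hw
  obtain ⟨hfa, hfw, hw2⟩ := hlog w (by linarith [hnorm w hw]) (hnot w hw)
  obtain ⟨-, -, hz2⟩ := hlog z (by linarith [hnorm z hzz]) (hnot z hzz)
  refine ⟨hfa, hfw, ?_⟩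
  have hharm : HarmonicOnNhd (fun x => log ‖g x‖) (closedBall 0 (4 * R)) := fun x hx =>
    (hg x hx).harmonicAt_log_norm (hg0 x hx)
  have hosc := abs_sub_le_of_harmonicOnNhd (by linarith) hharm (hnorm z hzz) (hnorm w hw)
  have hg_le : |log ‖g w‖ - log ‖g z‖| ≤ 1 / 2 := by
    refine hosc.trans ?_
    have hB : circleAverage (fun z => |log ‖g z‖|) 0 (4 * R) ≤ 2 * (q + 1) ^ 2 * (1 + log (8 * R)) := by
      refine hgavg.trans ?_
      have : 2 * (4 * R) = 8 * R := by ring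
      rw [this]
      have h1 : n * (2 * log (8 * R)) ≤ q * (2 * log (8 * R)) := by gcongr
      nlinarith [mul_nonneg hq0 hl, mul_nonneg (mul_nonneg hq0 hq0) hl]
    have h8 : 8 * ‖w - z‖ / (4 * R) ≤ 2 * D / R := by
      rw [div_le_div_iff₀ (by linarith) (by linarith)]
      nlinarith
    calc _ ≤ 2 * D / R * (2 * (q + 1) ^ 2 * (1 + log (8 * R))) := by
          gcongr
          exact circleAverage_nonneg_of_nonneg fun _ _ => abs_nonneg _
      _ ≤ 1 / 2 := by
          rw [div_mul_eq_mul_div, div_le_iff₀ (by linarith)]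
          have : 0 ≤ (q + 1) ^ 2 * (1 + log (8 * R)) := by positivity
          nlinarith
  have hsum_le : |∑ u ∈ s, (divisor f univ u : ℝ) * log ‖w - u‖
      - ∑ u ∈ s, (divisor f univ u : ℝ) * log ‖z - u‖| ≤ 1 / 2 := by
    rw [← Finset.sum_sub_distrib]
    calc _ ≤ ∑ u ∈ s, |(divisor f univ u : ℝ)| * (D / (δ / 2)) := by
          refine (Finset.abs_sum_le_sum_abs _ _).trans (Finset.sum_le_sum fun u hu => ?_)
          rw [← mul_sub, abs_mul]
          gcongr
          refine abs_log_sub_log_le (by linarith) (hfar w hw u hu) (hfar z hzz u hu) ?_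
          refine (abs_norm_sub_norm_le _ _).trans ?_
          rwa [sub_sub_sub_cancel_right]
      _ = n * (D / (δ / 2)) := by rw [← Finset.sum_mul]
      _ ≤ q * (D / (δ / 2)) := by gcongr
      _ = 16 * (q * (q + 1)) * D / R := by rw [hδ]; field_simp; ring
      _ ≤ 1 / 2 := by
          rw [div_le_iff₀ (by linarith)]
          nlinarith [mul_nonneg hq0 hD, mul_nonneg (mul_nonneg hq0 hD) hq0]
  rw [hw2, hz2, abs_le]
  rw [abs_le] at hg_le hsum_le
  constructor <;> linarith [hg_le.1, hg_le.2, hsum_le.1, hsum_le.2]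

/-! ### Zeros, poles and mean values in terms of the characteristic -/

theorem characteristic_inv_le {f : ℂ → ℂ} (hf : Meromorphic f) {r : ℝ} (hr : r ≠ 0) :
    characteristic f⁻¹ ⊤ r ≤ characteristic f ⊤ r + |log ‖meromorphicTrailingCoeffAt f 0‖| := by
  have := characteristic_sub_characteristic_inv_of_ne_zero hf hr
  have := neg_abs_le (log ‖meromorphicTrailingCoeffAt f 0‖)
  linarith

theorem logCounting_le_characteristic (f : ℂ → ℂ) (r : ℝ) :
    logCounting f ⊤ r ≤ characteristic f ⊤ r := by
  have := proximity_nonneg (f := f) (a := ⊤) r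
  simp only [characteristic, Pi.add_apply]
  simp only [Pi.zero_apply] at this
  linarith

theorem proximity_le_characteristic (f : ℂ → ℂ) {r : ℝ} (hr : 1 ≤ r) :
    proximity f ⊤ r ≤ characteristic f ⊤ r := by
  have := logCounting_nonneg (f := f) (e := ⊤) hr
  simp only [characteristic, Pi.add_apply]
  linarith

theorem sum_abs_divisor_le {f : ℂ → ℂ} (hf : Meromorphic f) {r : ℝ} (hr : 1 ≤ r) (s : Finset ℂ)
    (hs : ∀ z ∈ s, ‖z‖ ≤ r) :
    ∑ z ∈ s, |(divisor f univ z : ℝ)| ≤ 4 * characteristic f ⊤ (2 * r)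
      + 2 * |log ‖meromorphicTrailingCoeffAt f 0‖| := by
  have h1 := sum_mul_log_two_le_logCounting (posPart_nonneg (divisor f univ)) hr s hs
  have h2 := sum_mul_log_two_le_logCounting (negPart_nonneg (divisor f univ)) hr s hs
  rw [← logCounting_zero, ← logCounting_inv] at h1
  rw [← logCounting_top] at h2
  have h3 := h1.trans (logCounting_le_characteristic _ _)
  have h4 := h2.trans (logCounting_le_characteristic _ _)
  have h5 := characteristic_inv_le hf (r := 2 * r) (by linarith)
  have habs : ∑ z ∈ s, |(divisor f univ z : ℝ)| = ∑ z ∈ s, (((divisor f univ)⁺ z : ℤ) : ℝ)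
      + ∑ z ∈ s, (((divisor f univ)⁻ z : ℤ) : ℝ) := by
    rw [← Finset.sum_add_distrib]
    refine Finset.sum_congr rfl fun z _ => ?_
    rw [locallyFinsuppWithin.posPart_apply, locallyFinsuppWithin.negPart_apply]
    rw [← Int.cast_abs, ← posPart_add_negPart]
    push_cast
    rfl
  have hl : 1 / 2 ≤ log 2 := by linarith [log_two_gt_d9]
  have hnn : 0 ≤ ∑ z ∈ s, |(divisor f univ z : ℝ)| := Finset.sum_nonneg fun _ _ => abs_nonneg _
  have := mul_le_mul_of_nonneg_left hl hnn
  rw [habs] at *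
  linarith

theorem circleAverage_abs_log_norm_le {f : ℂ → ℂ} (hf : Meromorphic f) {r : ℝ} (hr : 1 ≤ r) :
    circleAverage (fun z => |log ‖f z‖|) 0 r ≤ 2 * characteristic f ⊤ r
      + |log ‖meromorphicTrailingCoeffAt f 0‖| := by
  have h1 : circleAverage (fun z => |log ‖f z‖|) 0 r = proximity f ⊤ r + proximity f⁻¹ ⊤ r := by
    rw [proximity_top, proximity_top, ← circleAverage_add
      (circleIntegrable_posLog_norm (hf.meromorphicOn))
      (circleIntegrable_posLog_norm (hf.inv.meromorphicOn))]
    congr 1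
    ext z
    rw [Pi.add_apply, Pi.inv_apply, norm_inv, posLog_apply, posLog_apply, log_inv]
    rcases le_total 0 (log ‖f z‖) with h | h <;> simp [abs_of_nonneg, abs_of_nonpos, h]
  have h2 := proximity_le_characteristic f hr
  have h3 := proximity_le_characteristic f⁻¹ hr
  have h4 := characteristic_inv_le hf (r := r) (by linarith)
  linarith

/-- A polylogarithmic quantity is eventually below `R`, in the form demanded by
`exists_radius_abs_log_norm_sub_le_one`. -/
theorem eventually_log_pow_le (K : ℕ) (C D : ℝ) (hC : 0 ≤ C) (hD : 0 ≤ D) :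
    ∀ᶠ R : ℝ in atTop,
      64 * (D + 1) * ((4 * log (8 * R) ^ K + C) + 1) ^ 2 * (1 + log (8 * R)) ≤ R := by
  set M := 64 * (D + 1) * (5 + C) ^ 2 * 2 with hM
  have hM0 : 0 < M := by positivity
  have hx : Tendsto (fun R : ℝ => 8 * R) atTop atTop :=
    tendsto_id.const_mul_atTop (by norm_num)
  have h1 := hx.eventually ((isLittleO_pow_log_id_atTop (n := 2 * K + 1)).bound
    (show 0 < 1 / (8 * M) by positivity))
  filter_upwards [h1, hx.eventually (tendsto_log_atTop.eventually_ge_atTop 1),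
    eventually_ge_atTop 1] with R h1 h2 h3
  set L := log (8 * R) with hL
  have hLK : 1 ≤ L ^ K := one_le_pow₀ h2
  rw [norm_of_nonneg (by positivity), id_eq, norm_of_nonneg (by linarith)] at h1
  have h4 : M * L ^ (2 * K + 1) ≤ R := by
    calc M * L ^ (2 * K + 1) ≤ M * (1 / (8 * M) * (8 * R)) := by gcongr
      _ = R := by field_simp
  refine le_trans ?_ h4
  have h5 : 4 * L ^ K + C + 1 ≤ (5 + C) * L ^ K := by nlinarith
  calc _ ≤ 64 * (D + 1) * ((5 + C) * L ^ K) ^ 2 * (2 * L) := by gcongr; linarith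
    _ = M * L ^ (2 * K + 1) := by rw [hM]; ring

/-! ### Local oscillation of functions of finite logarithmic order -/

/-- A meromorphic function of finite logarithmic order varies by a bounded factor over discs of
fixed radius centred on suitable circles, one in each large annulus `R / 2 ≤ ‖z‖ ≤ R`. -/
theorem eventually_exists_radius_abs_log_norm_sub_le_one {f : ℂ → ℂ}
    (hf : MeromorphicNFOn f univ) (hf0 : ∀ z, meromorphicOrderAt f z ≠ ⊤) {K : ℕ}
    (hK : ∀ᶠ r in atTop, characteristic f ⊤ r ≤ log r ^ K) {D : ℝ} (hD : 0 ≤ D) :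
    ∀ᶠ R : ℝ in atTop, ∃ r ∈ Icc (R / 2) R, ∀ z : ℂ, ‖z‖ = r → ∀ w, ‖w - z‖ ≤ D →
      AnalyticAt ℂ f w ∧ f w ≠ 0 ∧ |log ‖f w‖ - log ‖f z‖| ≤ 1 := by
  have hfm : Meromorphic f := fun z => hf.meromorphicOn z (mem_univ z)
  have hx : Tendsto (fun R : ℝ => 8 * R) atTop atTop :=
    tendsto_id.const_mul_atTop (by norm_num)
  set C := 2 * |log ‖meromorphicTrailingCoeffAt f 0‖| with hC
  filter_upwards [hx.eventually hK, eventually_ge_atTop 1,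
    eventually_log_pow_le K C D (by positivity) hD] with R h1 h2 h3
  have hT0 : 0 ≤ characteristic f ⊤ (8 * R) := characteristic_nonneg (by linarith)
  refine exists_radius_abs_log_norm_sub_le_one hf hf0 h2 hD (fun s hs => ?_) ?_ h3
  · refine (sum_abs_divisor_le hfm (by linarith) s hs).trans ?_
    have : 2 * (4 * R) = 8 * R := by ring
    rw [this]
    linarith
  · refine (circleAverage_abs_log_norm_le hfm (by linarith)).trans ?_
    have := characteristic_monotoneOn hfm (a := 4 * R) (b := 8 * R) (by simp; linarith)
      (by simp; linarith) (by linarith)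
    have := abs_nonneg (log ‖meromorphicTrailingCoeffAt f 0‖)
    linarith

/-! ### The basic inequality for solutions -/

/-- Circle averages are monotone under inequalities which hold off a discrete set. -/
theorem circleAverage_mono_codiscreteWithin {u v : ℂ → ℝ} {r : ℝ} (hr : r ≠ 0)
    (hu : CircleIntegrable u 0 r) (hv : CircleIntegrable v 0 r)
    (h : ∀ᶠ z in codiscreteWithin (sphere (0 : ℂ) |r|), u z ≤ v z) :
    circleAverage u 0 r ≤ circleAverage v 0 r := by
  have heq : u =ᶠ[codiscreteWithin (sphere (0 : ℂ) |r|)] fun z => min (u z) (v z) := by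
    filter_upwards [h] with z hz
    exact (min_eq_left hz).symm
  rw [circleAverage_congr_codiscreteWithin heq hr]
  exact circleAverage_mono (hu.congr_codiscreteWithin heq) hv fun z _ => min_le_right _ _

/-- The set of points near which two identical meromorphic functions agree is itself codiscrete. -/
theorem MerEq.eventually_nhdsNE {f g : ℂ → ℂ} (h : MerEq f g) (x : ℂ) :
    ∀ᶠ y in 𝓝[≠] x, f =ᶠ[𝓝 y] g := by
  have hx : ∀ᶠ y in 𝓝[≠] x, f y = g y := by
    have := mem_codiscrete.1 h x
    rwa [disjoint_principal_right, compl_compl] at this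
  have h2 : ∀ᶠ y in 𝓝[≠] x, ∀ᶠ t in 𝓝[≠] y, f t = g t := by
    rw [eventually_nhdsWithin_iff] at hx ⊢
    filter_upwards [eventually_eventually_nhds.2 hx] with y hy hyx
    rw [eventually_nhdsWithin_iff]
    filter_upwards [hy, isOpen_ne.mem_nhds hyx] with t ht htx _
    exact ht htx
  filter_upwards [hx, h2] with y hy1 hy2
  rw [eventually_nhdsWithin_iff] at hy2
  filter_upwards [hy2] with t ht
  by_cases hty : t = y
  · rw [hty, hy1]
  · exact ht hty

theorem eventually_codiscrete_iff {p : ℂ → Prop} :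
    (∀ᶠ z in codiscrete ℂ, p z) ↔ ∀ x, ∀ᶠ z in 𝓝[≠] x, p z := by
  rw [Filter.Eventually, mem_codiscrete]
  refine forall_congr' fun x => ?_
  rw [disjoint_principal_right, compl_compl]
  rfl

/-- Derivatives and shifts respect identity of meromorphic functions. -/
theorem MerEq.iteratedDeriv_comp_add {f g : ℂ → ℂ} (h : MerEq f g) (j : ℕ) (c : ℂ) :
    ∀ᶠ z in codiscrete ℂ, iteratedDeriv j f (z + c) = iteratedDeriv j g (z + c) := by
  rw [eventually_codiscrete_iff]
  intro x
  have ht : Tendsto (· + c) (𝓝[≠] x) (𝓝[≠] (x + c)) := by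
    refine tendsto_nhdsWithin_iff.2 ⟨?_, ?_⟩
    · exact (Continuous.tendsto (by fun_prop) x).mono_left nhdsWithin_le_nhds
    · filter_upwards [self_mem_nhdsWithin] with z hz
      simpa using hz
  filter_upwards [ht.eventually (h.eventually_nhdsNE (x + c))] with z hz
  exact hz.iteratedDeriv_eq j

theorem meromorphicOrderAt_ne_top_of_not_merEq_zero {f : ℂ → ℂ} (hf : Meromorphic f)
    (h : ¬ MerEq f 0) (z : ℂ) : meromorphicOrderAt f z ≠ ⊤ := by
  refine hf.exists_meromorphicOrderAt_ne_top_iff_forall.1 ?_ z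
  by_contra! hcon
  refine h (eventually_codiscrete_iff.2 fun x => ?_)
  exact meromorphicOrderAt_eq_top_iff.1 (hcon x)

open Classical in
/-- Solving the equation for the distinguished coefficient on a circle on which `f` barely
oscillates bounds its proximity function by those of the other coefficients and of `F / f`. -/
theorem exists_radius_proximity_le {n m : ℕ} {A : Fin (n + 1) → Fin (m + 1) → ℂ → ℂ} {F f : ℂ → ℂ}
    {c : Fin (n + 1) → ℂ} (l : Fin (n + 1)) (hA : ∀ i j, Meromorphic (A i j)) (hF : Meromorphic F)
    (hsol : IsMeromorphicSolution A c F f) (hf0 : ¬ MerEq f 0) {K : ℕ}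
    (hK : ∀ᶠ r in atTop, nevT f r ≤ log r ^ K) :
    ∃ C, ∀ᶠ R : ℝ in atTop, ∃ r ∈ Icc (R / 2) R, proximity (A l 0) ⊤ r ≤
      ∑ p ∈ Finset.univ.erase (l, 0), proximity (A p.1 p.2) ⊤ r + proximity (F * f⁻¹) ⊤ r + C := by
  obtain ⟨hf, heq⟩ := hsol
  set g := toMeromorphicNFOn f univ with hg
  have hfg : MerEq f g := toMeromorphicNFOn_eqOn_codiscrete hf.meromorphicOn
  have hgNF : MeromorphicNFOn g univ := meromorphicNFOn_toMeromorphicNFOn f univ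
  have hg0 : ∀ z, meromorphicOrderAt g z ≠ ⊤ := fun z => by
    rw [hg, meromorphicOrderAt_toMeromorphicNFOn hf.meromorphicOn (mem_univ z)]
    exact meromorphicOrderAt_ne_top_of_not_merEq_zero hf hf0 z
  have hgm : Meromorphic g := fun z => hgNF.meromorphicOn z (mem_univ z)
  have hgK : ∀ᶠ r in atTop, characteristic g ⊤ r ≤ log r ^ K := by
    filter_upwards [hK, eventually_gt_atTop 0] with r hr hr0
    rwa [← characteristic_congr_codiscrete hfg hr0.ne']
  set D := 1 + ∑ i, ‖c i‖ with hD
  have hcD : ∀ i, ‖c i‖ + 1 ≤ D := fun i => by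
    rw [hD, add_comm]
    gcongr
    exact Finset.single_le_sum (f := fun i => ‖c i‖) (fun _ _ => norm_nonneg _) (Finset.mem_univ i)
  have hD0 : 0 ≤ D := by positivity
  -- the equation holds for the normal form off a discrete set
  have hgeq : ∀ᶠ z in codiscrete ℂ,
      ∑ p : Fin (n + 1) × Fin (m + 1), A p.1 p.2 z * iteratedDeriv (p.2 : ℕ) g (z + c p.1) = F z := by
    have h1 : ∀ᶠ z in codiscrete ℂ, ∀ p : Fin (n + 1) × Fin (m + 1),
        iteratedDeriv (p.2 : ℕ) f (z + c p.1) = iteratedDeriv (p.2 : ℕ) g (z + c p.1) :=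
      eventually_all.2 fun p => hfg.iteratedDeriv_comp_add p.2 (c p.1)
    filter_upwards [h1, heq] with z h1 h2
    rw [← h2, Fintype.sum_prod_type]
    simp only [h1 (_, _)]
  set M := (m.factorial : ℝ) * exp 1 * exp 1 with hM
  have hM0 : 0 ≤ M := by positivity
  set s : Finset (Fin (n + 1) × Fin (m + 1)) := Finset.univ.erase (l, 0) with hs
  refine ⟨log⁺ M + log 2 + log s.card, ?_⟩
  filter_upwards [eventually_exists_radius_abs_log_norm_sub_le_one hgNF hg0 hgK hD0,
    eventually_gt_atTop 0] with R hR hR0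
  obtain ⟨r, hr, hrz⟩ := hR
  refine ⟨r, hr, ?_⟩
  have hr0 : 0 < r := by linarith [hr.1]
  -- comparison of values of `g` near the circle
  have hcomp : ∀ z : ℂ, ‖z‖ = r → ∀ w, ‖w - z‖ ≤ D →
      ‖g w‖ ≤ exp 1 * ‖g z‖ ∧ ‖g z‖ ≤ exp 1 * ‖g w‖ := by
    intro z hz w hw
    obtain ⟨-, hw0, hwz⟩ := hrz z hz w hw
    obtain ⟨-, hz0, -⟩ := hrz z hz z (by simpa using hD0)
    have key : ∀ a b : ℝ, 0 < a → 0 < b → log a - log b ≤ 1 → a ≤ exp 1 * b := by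
      intro a b ha hb hab
      rw [← exp_log ha, ← exp_log hb, ← exp_add]
      exact exp_le_exp.2 (by linarith)
    rw [abs_le] at hwz
    exact ⟨key _ _ (norm_pos_iff.2 hw0) (norm_pos_iff.2 hz0) hwz.2,
      key _ _ (norm_pos_iff.2 hz0) (norm_pos_iff.2 hw0) (by linarith)⟩
  have hderiv : ∀ z : ℂ, ‖z‖ = r → ∀ p : Fin (n + 1) × Fin (m + 1),
      ‖iteratedDeriv (p.2 : ℕ) g (z + c p.1)‖ ≤ M * ‖g (z + c l)‖ := by
    intro z hz p
    have hball : ∀ w ∈ closedBall (z + c p.1) 1, ‖w - z‖ ≤ D := fun w hw => by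
      have h1 : ‖w - (z + c p.1)‖ ≤ 1 := by simpa [dist_eq_norm] using hw
      calc ‖w - z‖ = ‖(w - (z + c p.1)) + c p.1‖ := by ring_nf
        _ ≤ ‖w - (z + c p.1)‖ + ‖c p.1‖ := norm_add_le _ _
        _ ≤ D := by linarith [hcD p.1]
    have hdiff : DifferentiableOn ℂ g (closedBall (z + c p.1) 1) := fun w hw =>
      (hrz z hz w (hball w hw)).1.differentiableAt.differentiableWithinAt
    have h1 := Complex.norm_iteratedDeriv_le_of_forall_mem_sphere_norm_le (p.2 : ℕ) one_pos
      (hdiff.diffContOnCl_ball subset_rfl)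
      fun w hw => (hcomp z hz w (hball w (sphere_subset_closedBall hw))).1
    rw [one_pow, div_one] at h1
    refine h1.trans ?_
    have h2 := (hcomp z hz (z + c l) (by simpa using by linarith [hcD l])).2
    have h3 : ((p.2 : ℕ).factorial : ℝ) ≤ m.factorial := by
      exact_mod_cast Nat.factorial_le (by omega)
    calc _ ≤ (m.factorial : ℝ) * (exp 1 * (exp 1 * ‖g (z + c l)‖)) := by gcongr
      _ = M * ‖g (z + c l)‖ := by rw [hM]; ring
  have hpt : ∀ z : ℂ, ‖z‖ = r →
      ∑ p : Fin (n + 1) × Fin (m + 1), A p.1 p.2 z * iteratedDeriv (p.2 : ℕ) g (z + c p.1) = F z →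
      ‖A l 0 z‖ ≤ M * (‖(F * g⁻¹) z‖ + ∑ p ∈ s, ‖A p.1 p.2 z‖) := by
    intro z hz hE
    rw [← Finset.add_sum_erase _ _ (Finset.mem_univ ((l, 0) : Fin (n + 1) × Fin (m + 1)))] at hE
    simp only [Fin.val_zero, iteratedDeriv_zero] at hE
    have hl : ‖z + c l - z‖ ≤ D := by simpa using by linarith [hcD l]
    have hl0 : 0 < ‖g (z + c l)‖ := norm_pos_iff.2 (hrz z hz _ hl).2.1
    have hz0 : 0 < ‖g z‖ := norm_pos_iff.2 (hrz z hz z (by simpa using hD0)).2.1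
    have h1 : A l 0 z * g (z + c l) = F z
        - ∑ p ∈ s, A p.1 p.2 z * iteratedDeriv (p.2 : ℕ) g (z + c p.1) := by
      rw [← hE, add_sub_cancel_right]
    have hF_le : ‖F z‖ ≤ M * ‖(F * g⁻¹) z‖ * ‖g (z + c l)‖ := by
      have h2 := (hcomp z hz (z + c l) hl).2
      have h3 : exp 1 ≤ M := by
        have : (1 : ℝ) ≤ m.factorial := by exact_mod_cast Nat.factorial_pos m
        have h4 : (1 : ℝ) ≤ exp 1 := one_le_exp zero_le_one
        rw [hM]
        nlinarith [mul_le_mul this h4 zero_le_one (by positivity)]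
      calc ‖F z‖ = ‖(F * g⁻¹) z‖ * ‖g z‖ := by
            simp only [Pi.mul_apply, Pi.inv_apply, norm_mul, norm_inv]
            field_simp
        _ ≤ ‖(F * g⁻¹) z‖ * (M * ‖g (z + c l)‖) := by
            gcongr
            exact h2.trans (by gcongr)
        _ = _ := by ring
    refine le_of_mul_le_mul_right ?_ hl0
    rw [← norm_mul, h1]
    calc _ ≤ ‖F z‖ + ∑ p ∈ s, ‖A p.1 p.2 z‖ * (M * ‖g (z + c l)‖) := by
          refine (norm_sub_le _ _).trans (add_le_add le_rfl ?_)
          refine (norm_sum_le _ _).trans (Finset.sum_le_sum fun p _ => ?_)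
          rw [norm_mul]
          gcongr
          exact hderiv z hz p
      _ ≤ M * ‖(F * g⁻¹) z‖ * ‖g (z + c l)‖ + ∑ p ∈ s, ‖A p.1 p.2 z‖ * (M * ‖g (z + c l)‖) := by
          gcongr
      _ = _ := by rw [← Finset.sum_mul]; ring
  have hfgF : F * f⁻¹ =ᶠ[codiscrete ℂ] F * g⁻¹ := by
    filter_upwards [hfg] with z hz
    simp [hz]
  rw [proximity_congr_codiscrete hfgF hr0.ne']
  simp only [proximity_top]
  have hiA : ∀ p : Fin (n + 1) × Fin (m + 1),
      CircleIntegrable (fun z => log⁺ ‖A p.1 p.2 z‖) 0 r := fun p =>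
    circleIntegrable_posLog_norm (hA p.1 p.2).meromorphicOn
  have hiF : CircleIntegrable (fun z => log⁺ ‖(F * g⁻¹) z‖) 0 r :=
    circleIntegrable_posLog_norm (hF.mul hgm.inv).meromorphicOn
  have hiS : CircleIntegrable (fun z => ∑ p ∈ s, log⁺ ‖A p.1 p.2 z‖) 0 r :=
    CircleIntegrable.fun_sum s fun p _ => hiA p
  have hiSF : CircleIntegrable
      (fun z => ∑ p ∈ s, log⁺ ‖A p.1 p.2 z‖ + log⁺ ‖(F * g⁻¹) z‖) 0 r := hiS.add hiF
  have hic : CircleIntegrable (fun _ : ℂ => log⁺ M + log 2 + log s.card) 0 r :=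
    circleIntegrable_const _ _ _
  calc circleAverage (fun z => log⁺ ‖A l 0 z‖) 0 r
      ≤ circleAverage (fun z => ∑ p ∈ s, log⁺ ‖A p.1 p.2 z‖ + log⁺ ‖(F * g⁻¹) z‖
          + (log⁺ M + log 2 + log s.card)) 0 r := by
        refine circleAverage_mono_codiscreteWithin hr0.ne' (hiA (l, 0)) (hiSF.add hic) ?_
        have h1 := hgeq.filter_mono (codiscreteWithin_mono (subset_univ (sphere (0 : ℂ) |r|)))
        filter_upwards [h1, self_mem_codiscreteWithin (sphere (0 : ℂ) |r|)] with z hz1 hz2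
        have hz : ‖z‖ = r := by simpa [abs_of_pos hr0] using hz2
        have h2 := posLog_le_posLog (norm_nonneg _) (hpt z hz hz1)
        have h3 := posLog_mul (x := M) (y := ‖(F * g⁻¹) z‖ + ∑ p ∈ s, ‖A p.1 p.2 z‖)
        have h4 := posLog_add (x := ‖(F * g⁻¹) z‖) (y := ∑ p ∈ s, ‖A p.1 p.2 z‖)
        have h5 := posLog_sum s fun p => ‖A p.1 p.2 z‖
        linarith
    _ = _ := by
        rw [circleAverage_fun_add hiSF hic, circleAverage_fun_add hiS hiF, circleAverage_const,
          circleAverage_fun_sum fun p _ => hiA p]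

theorem nevT_nonneg (f : ℂ → ℂ) {r : ℝ} (hr : 1 ≤ r) : 0 ≤ nevT f r :=
  characteristic_nonneg hr

theorem nevT_mono {f : ℂ → ℂ} (hf : Meromorphic f) {r R : ℝ} (hr : 0 < r) (hR : r ≤ R) :
    nevT f r ≤ nevT f R :=
  characteristic_monotoneOn hf hr (hr.trans_le hR) hR

theorem nevT_half_le_of_exists_radius {n m : ℕ} {A : Fin (n + 1) → Fin (m + 1) → ℂ → ℂ}
    (hA : ∀ i j, Meromorphic (A i j)) (l : Fin (n + 1)) {s : Finset (Fin (n + 1) × Fin (m + 1))}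
    {R X : ℝ} (hR : 2 ≤ R) (h : ∃ r ∈ Icc (R / 2) R, proximity (A l 0) ⊤ r ≤
      ∑ p ∈ s, proximity (A p.1 p.2) ⊤ r + X) :
    nevT (A l 0) (R / 2) ≤ logCounting (A l 0) ⊤ R + ∑ p ∈ s, nevT (A p.1 p.2) R + X := by
  obtain ⟨r, hr, hle⟩ := h
  have hr1 : 1 ≤ r := by linarith [hr.1]
  have h1 : nevT (A l 0) (R / 2) ≤ nevT (A l 0) r := nevT_mono (hA l 0) (by linarith) hr.1
  have h2 : nevT (A l 0) r = proximity (A l 0) ⊤ r + logCounting (A l 0) ⊤ r := rfl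
  have h3 : logCounting (A l 0) ⊤ r ≤ logCounting (A l 0) ⊤ R :=
    logCounting_monotoneOn (show (0 : ℝ) < r by linarith) (show (0 : ℝ) < R by linarith) hr.2
  have h4 : ∑ p ∈ s, proximity (A p.1 p.2) ⊤ r ≤ ∑ p ∈ s, nevT (A p.1 p.2) R :=
    Finset.sum_le_sum fun p _ => (proximity_le_characteristic _ hr1).trans
      (nevT_mono (hA p.1 p.2) (by linarith) hr.2)
  linarith

open Classical in
/-- The characteristic of the distinguished coefficient in terms of its poles, the remaining
coefficients, the right-hand side and the solution. -/
theorem exists_eventually_nevT_half_le {n m : ℕ} {A : Fin (n + 1) → Fin (m + 1) → ℂ → ℂ}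
    {F f : ℂ → ℂ} {c : Fin (n + 1) → ℂ} (l : Fin (n + 1)) (hA : ∀ i j, Meromorphic (A i j))
    (hF : Meromorphic F) (hsol : IsMeromorphicSolution A c F f) (hf0 : ¬ MerEq f 0) {K : ℕ}
    (hK : ∀ᶠ r in atTop, nevT f r ≤ log r ^ K) :
    ∃ C, ∀ᶠ R : ℝ in atTop, nevT (A l 0) (R / 2) ≤ logCounting (A l 0) ⊤ R
      + ∑ p ∈ Finset.univ.erase (l, 0), nevT (A p.1 p.2) R + (nevT F R + nevT f R + C) := by
  obtain ⟨C, hC⟩ := exists_radius_proximity_le l hA hF hsol hf0 hK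
  refine ⟨|log ‖meromorphicTrailingCoeffAt f 0‖| + C, ?_⟩
  filter_upwards [hC, eventually_ge_atTop 2] with R ⟨r, hr, hle⟩ hR
  refine nevT_half_le_of_exists_radius hA l hR ⟨r, hr, hle.trans ?_⟩
  have hr1 : 1 ≤ r := by linarith [hr.1]
  have h1 : proximity (F * f⁻¹) ⊤ r ≤ proximity F ⊤ r + proximity f⁻¹ ⊤ r :=
    proximity_mul_top_le hF hsol.1.inv r
  have h2 : proximity F ⊤ r ≤ nevT F R :=
    (proximity_le_characteristic _ hr1).trans (nevT_mono hF (by linarith) hr.2)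
  have h3 := proximity_le_characteristic f⁻¹ hr1
  have h4 := characteristic_inv_le hsol.1 (r := r) (by linarith)
  have h5 : characteristic f ⊤ r ≤ nevT f R := nevT_mono hsol.1 (by linarith) hr.2
  linarith

open Classical in
/-- For the homogeneous equation, the solution does not enter the bound. -/
theorem exists_eventually_nevT_half_le_of_homogeneous {n m : ℕ}
    {A : Fin (n + 1) → Fin (m + 1) → ℂ → ℂ} {f : ℂ → ℂ} {c : Fin (n + 1) → ℂ} (l : Fin (n + 1))
    (hA : ∀ i j, Meromorphic (A i j)) (hsol : IsMeromorphicSolution A c 0 f) (hf0 : ¬ MerEq f 0)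
    {K : ℕ} (hK : ∀ᶠ r in atTop, nevT f r ≤ log r ^ K) :
    ∃ C, ∀ᶠ R : ℝ in atTop, nevT (A l 0) (R / 2) ≤ logCounting (A l 0) ⊤ R
      + ∑ p ∈ Finset.univ.erase (l, 0), nevT (A p.1 p.2) R + C := by
  obtain ⟨C, hC⟩ := exists_radius_proximity_le l hA (F := 0)
    (fun z => MeromorphicAt.const 0 z) hsol hf0 hK
  refine ⟨C, ?_⟩
  filter_upwards [hC, eventually_ge_atTop 2] with R ⟨r, hr, hle⟩ hR
  refine nevT_half_le_of_exists_radius hA l hR ⟨r, hr, hle.trans_eq ?_⟩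
  have h0 : proximity ((0 : ℂ → ℂ) * f⁻¹) ⊤ r = 0 := by
    rw [zero_mul, proximity_top]
    simp [circleAverage_const]
  rw [h0, add_zero]

/-! ### Logarithmic order and growth -/

theorem eventually_log_log_pos : ∀ᶠ r : ℝ in atTop, 0 < log (log r) :=
  (tendsto_log_atTop.comp tendsto_log_atTop).eventually_gt_atTop 0

theorem elog_div_lt_iff {x y r : ℝ} (hr : 0 < log (log r)) (hr' : 0 < log r) :
    elog x / ((log (log r) : ℝ) : EReal) < y ↔ x < log r ^ y := by
  rw [EReal.div_lt_iff (by exact_mod_cast hr) (EReal.coe_ne_top _), elog, ← EReal.coe_mul]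
  have hpos : 0 < log r ^ y := rpow_pos_of_pos hr' y
  rcases le_or_gt x 0 with hx | hx
  · simp [ENNReal.log_ofReal, hx, hx.trans_lt hpos]
    simpa using EReal.bot_lt_coe (y * log (log r))
  · rw [ENNReal.log_ofReal_of_pos hx, EReal.coe_lt_coe_iff, ← log_rpow hr',
      log_lt_log_iff hx hpos]

theorem eventually_lt_rpow_of_limsup_lt {φ : ℝ → ℝ} {y : ℝ}
    (h : limsup (fun r : ℝ => elog (φ r) / ((log (log r) : ℝ) : EReal)) atTop < y) :
    ∀ᶠ r in atTop, φ r < log r ^ y := by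
  filter_upwards [eventually_lt_of_limsup_lt h, eventually_log_log_pos,
    tendsto_log_atTop.eventually_gt_atTop 0] with r h1 h2 h3
  exact (elog_div_lt_iff h2 h3).1 h1

theorem frequently_lt_rpow_of_liminf_lt {φ : ℝ → ℝ} {y : ℝ}
    (h : liminf (fun r : ℝ => elog (φ r) / ((log (log r) : ℝ) : EReal)) atTop < y) :
    ∃ᶠ r in atTop, φ r < log r ^ y := by
  have := frequently_lt_of_liminf_lt (by isBoundedDefault) h
  refine (this.and_eventually (eventually_log_log_pos.and
    (tendsto_log_atTop.eventually_gt_atTop 0))).mono fun r hr => ?_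
  exact (elog_div_lt_iff hr.2.1 hr.2.2).1 hr.1

theorem eventually_rpow_le_of_lt_liminf {φ : ℝ → ℝ} {y : ℝ}
    (h : y < liminf (fun r : ℝ => elog (φ r) / ((log (log r) : ℝ) : EReal)) atTop) :
    ∀ᶠ r in atTop, log r ^ y ≤ φ r := by
  filter_upwards [eventually_lt_of_lt_liminf h, eventually_log_log_pos,
    tendsto_log_atTop.eventually_gt_atTop 0] with r h1 h2 h3
  exact not_lt.1 fun hlt => h1.not_gt ((elog_div_lt_iff h2 h3).2 hlt)

theorem exists_eventually_nevT_le_log_pow {f : ℂ → ℂ} (h : logOrder f < ⊤) :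
    ∃ K : ℕ, ∀ᶠ r in atTop, nevT f r ≤ log r ^ K := by
  obtain ⟨y, hy, -⟩ := EReal.lt_iff_exists_real_btwn.1 h
  obtain ⟨K, hK⟩ := exists_nat_ge y
  refine ⟨K, ?_⟩
  filter_upwards [eventually_lt_rpow_of_limsup_lt hy, tendsto_log_atTop.eventually_ge_atTop 1]
    with r h1 h2
  rw [← rpow_natCast]
  exact h1.le.trans (rpow_le_rpow_of_exponent_le h2 hK)

/-- The quotient `φ r / (log r) ^ s`, as an extended real number. -/
noncomputable def logQuotient (φ : ℝ → ℝ) (s r : ℝ) : EReal :=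
  ((φ r / log r ^ s : ℝ) : EReal)

theorem tendsto_log_rpow_div {y s : ℝ} (h : y < s) :
    Tendsto (fun r => log r ^ y / log r ^ s) atTop (𝓝 0) := by
  have h1 := (tendsto_rpow_neg_atTop (sub_pos.2 h)).comp tendsto_log_atTop
  refine h1.congr' ?_
  filter_upwards [tendsto_log_atTop.eventually_gt_atTop 0] with r hr
  rw [comp_apply, neg_sub, rpow_sub hr]

theorem eventually_log_rpow_le_mul {y s ε : ℝ} (h : y < s) (hε : 0 < ε) :
    ∀ᶠ r in atTop, log r ^ y ≤ ε * log r ^ s := by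
  filter_upwards [(tendsto_log_rpow_div h).eventually_le_const hε,
    tendsto_log_atTop.eventually_gt_atTop 0] with r h1 h2
  rwa [div_le_iff₀ (rpow_pos_of_pos h2 s)] at h1

theorem limsup_logQuotient_le_zero {φ : ℝ → ℝ} {s : ℝ}
    (h : limsup (fun r : ℝ => elog (φ r) / ((log (log r) : ℝ) : EReal)) atTop < s) :
    limsup (logQuotient φ s) atTop ≤ 0 := by
  obtain ⟨y, hy, hys⟩ := EReal.lt_iff_exists_real_btwn.1 h
  rw [EReal.coe_lt_coe_iff] at hys
  refine EReal.le_of_forall_lt_iff_le.1 fun ε hε => limsup_le_of_le (by isBoundedDefault) ?_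
  filter_upwards [eventually_lt_rpow_of_limsup_lt hy,
    eventually_log_rpow_le_mul hys (EReal.coe_pos.1 hε),
    tendsto_log_atTop.eventually_gt_atTop 0] with r h1 h2 h3
  rw [logQuotient, EReal.coe_le_coe_iff, div_le_iff₀ (rpow_pos_of_pos h3 s)]
  exact h1.le.trans h2

theorem liminf_logQuotient_le_zero {φ : ℝ → ℝ} {s : ℝ}
    (h : liminf (fun r : ℝ => elog (φ r) / ((log (log r) : ℝ) : EReal)) atTop < s) :
    liminf (logQuotient φ s) atTop ≤ 0 := by
  obtain ⟨y, hy, hys⟩ := EReal.lt_iff_exists_real_btwn.1 h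
  rw [EReal.coe_lt_coe_iff] at hys
  refine EReal.le_of_forall_lt_iff_le.1 fun ε hε => liminf_le_of_frequently_le' ?_
  refine ((frequently_lt_rpow_of_liminf_lt hy).and_eventually
    ((eventually_log_rpow_le_mul hys (EReal.coe_pos.1 hε)).and
    (tendsto_log_atTop.eventually_gt_atTop 0))).mono fun r hr => ?_
  rw [logQuotient, EReal.coe_le_coe_iff, div_le_iff₀ (rpow_pos_of_pos hr.2.2 s)]
  exact hr.1.le.trans hr.2.1

theorem one_le_liminf_logQuotient {φ : ℝ → ℝ} {s : ℝ}
    (h : s < liminf (fun r : ℝ => elog (φ r) / ((log (log r) : ℝ) : EReal)) atTop) :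
    1 ≤ liminf (logQuotient φ s) atTop := by
  refine le_liminf_of_le (by isBoundedDefault) ?_
  filter_upwards [eventually_rpow_le_of_lt_liminf h,
    tendsto_log_atTop.eventually_gt_atTop 0] with r h1 h3
  rw [logQuotient, ← EReal.coe_one, EReal.coe_le_coe_iff, one_le_div (rpow_pos_of_pos h3 s)]
  exact h1

theorem liminf_logQuotient_nonneg {φ : ℝ → ℝ} (hφ : ∀ᶠ r in atTop, 0 ≤ φ r) (s : ℝ) :
    0 ≤ liminf (logQuotient φ s) atTop := by
  refine le_liminf_of_le (by isBoundedDefault) ?_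
  filter_upwards [hφ, tendsto_log_atTop.eventually_gt_atTop 0] with r h1 h3
  exact EReal.coe_nonneg.2 (div_nonneg h1 (rpow_pos_of_pos h3 s).le)

theorem limsup_logQuotient_nonneg {φ : ℝ → ℝ} (hφ : ∀ᶠ r in atTop, 0 ≤ φ r) (s : ℝ) :
    0 ≤ limsup (logQuotient φ s) atTop :=
  (liminf_logQuotient_nonneg hφ s).trans liminf_le_limsup

theorem eventually_nevT_nonneg (f : ℂ → ℂ) : ∀ᶠ r in atTop, 0 ≤ nevT f r := by
  filter_upwards [eventually_ge_atTop 1] with r hr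
  exact nevT_nonneg f hr

theorem logType_nonneg (f : ℂ → ℂ) : 0 ≤ logType f :=
  limsup_logQuotient_nonneg (eventually_nevT_nonneg f) _

theorem limsup_logQuotient_eq_logType {f : ℂ → ℂ} {s : ℝ} (h : logOrder f = s) :
    limsup (logQuotient (nevT f) s) atTop = logType f := by
  rw [logType, h, EReal.toReal_coe]
  rfl

theorem liminf_logQuotient_eq_logLowerType {f : ℂ → ℂ} {s : ℝ} (h : logLowerOrder f = s) :
    liminf (logQuotient (nevT f) s) atTop = logLowerType f := by
  rw [logLowerType, h, EReal.toReal_coe]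
  rfl

theorem logQuotient_add (φ ψ : ℝ → ℝ) (s : ℝ) :
    logQuotient (φ + ψ) s = logQuotient φ s + logQuotient ψ s := by
  ext r
  simp only [logQuotient, Pi.add_apply, add_div, EReal.coe_add]

theorem ne_bot_of_nonneg {x : EReal} (h : 0 ≤ x) : x ≠ ⊥ := by
  rintro rfl
  simp at h

theorem limsup_logQuotient_add_le {φ ψ : ℝ → ℝ} (hφ : ∀ᶠ r in atTop, 0 ≤ φ r)
    (hψ : ∀ᶠ r in atTop, 0 ≤ ψ r) (s : ℝ) :
    limsup (logQuotient (φ + ψ) s) atTop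
      ≤ limsup (logQuotient φ s) atTop + limsup (logQuotient ψ s) atTop := by
  rw [logQuotient_add]
  exact EReal.limsup_add_le (Or.inl (ne_bot_of_nonneg (limsup_logQuotient_nonneg hφ s)))
    (Or.inr (ne_bot_of_nonneg (limsup_logQuotient_nonneg hψ s)))

theorem limsup_logQuotient_sum_le {ι : Type*} (P : Finset ι) (φ : ι → ℝ → ℝ)
    (hφ : ∀ p ∈ P, ∀ᶠ r in atTop, 0 ≤ φ p r) (s : ℝ) :
    limsup (logQuotient (∑ p ∈ P, φ p) s) atTop
      ≤ ∑ p ∈ P, limsup (logQuotient (φ p) s) atTop := by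
  classical
  induction P using Finset.induction_on with
  | empty =>
    refine limsup_le_of_le (by isBoundedDefault) (Eventually.of_forall fun r => ?_)
    simp [logQuotient]
  | insert a P ha ih =>
    rw [Finset.sum_insert ha, Finset.sum_insert ha]
    have hP : ∀ p ∈ P, ∀ᶠ r in atTop, 0 ≤ φ p r := fun p hp => hφ p (Finset.mem_insert_of_mem hp)
    have hsum : ∀ᶠ r in atTop, 0 ≤ (∑ p ∈ P, φ p) r := by
      filter_upwards [(eventually_all_finset P).2 hP] with r hr
      rw [Finset.sum_apply]
      exact Finset.sum_nonneg hr
    exact (limsup_logQuotient_add_le (hφ a (Finset.mem_insert_self a P)) hsum s).trans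
      (add_le_add le_rfl (ih hP))

/-! ### Comparison of the data with a power of the logarithm -/

open Classical in
/-- The hypotheses on the coefficients single out an exponent `s` for which the distinguished
coefficient dominates, in the scale `(log r) ^ s`, the sum of all other data along a sequence of
radii. The exponent is the lower order `μ` of the distinguished coefficient if some other datum
reaches that order, and lies slightly below `μ` otherwise; `x` is a prescribed lower bound. -/
theorem exists_exponent_limsup_add_liminf_lt {n m : ℕ}
    {A : Fin (n + 1) → Fin (m + 1) → ℂ → ℂ} {F : ℂ → ℂ} {l a : Fin (n + 1)} {b : Fin (m + 1)}
    (hpos : 0 < logLowerOrder (A l 0)) (hfin : logLowerOrder (A l 0) < ⊤)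
    (h_i : max (logLowerOrder (A a b)) (logOrderOfSet (remainingData A F l a b)) ≤
      logLowerOrder (A l 0))
    (h_ii : logLowerOrder (A l 0) = logLowerOrder (A a b) →
      logLowerType (A a b) < logLowerType (A l 0))
    (h_iii : logLowerOrder (A l 0) = logOrderOfSet (remainingData A F l a b) →
      criticalTypeSum A l a b + logType F < logLowerType (A l 0))
    (h_iv : logLowerOrder (A l 0) = logLowerOrder (A a b) →
      logLowerOrder (A l 0) = logOrderOfSet (remainingData A F l a b) →
      criticalTypeSum A l a b + logType F + logLowerType (A a b) < logLowerType (A l 0))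
    {x : EReal} (hx : x < logLowerOrder (A l 0)) :
    ∃ s : ℝ, 0 < s ∧ x < s ∧
      limsup (logQuotient (∑ p ∈ (Finset.univ.erase (l, 0)).erase (a, b), nevT (A p.1 p.2)
        + nevT F) s) atTop + liminf (logQuotient (nevT (A a b)) s) atTop
      < liminf (logQuotient (nevT (A l 0)) s) atTop := by
  set P : Finset (Fin (n + 1) × Fin (m + 1)) := (Finset.univ.erase (l, 0)).erase (a, b) with hP
  have hPmem : ∀ p ∈ P, p ≠ (a, b) ∧ p ≠ (l, 0) := fun p hp => by
    simpa [hP] using hp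
  obtain ⟨hab_le, hS_le⟩ := max_le_iff.1 h_i
  have hF_le : logOrder F ≤ logOrderOfSet (remainingData A F l a b) :=
    le_iSup₂ (f := fun g _ => logOrder g) F (mem_insert _ _)
  have hA_le : ∀ p ∈ P, logOrder (A p.1 p.2) ≤ logOrderOfSet (remainingData A F l a b) :=
    fun p hp => le_iSup₂ (f := fun g _ => logOrder g) (A p.1 p.2)
      (mem_insert_of_mem _ ⟨p.1, p.2, (hPmem p hp).1, (hPmem p hp).2, rfl⟩)
  have hsplit : ∀ s : ℝ, limsup (logQuotient (∑ p ∈ P, nevT (A p.1 p.2) + nevT F) s) atTop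
      ≤ ∑ p ∈ P, limsup (logQuotient (nevT (A p.1 p.2)) s) atTop
        + limsup (logQuotient (nevT F) s) atTop := fun s => by
    refine (limsup_logQuotient_add_le ?_ (eventually_nevT_nonneg F) s).trans (add_le_add
      (limsup_logQuotient_sum_le P _ (fun p _ => eventually_nevT_nonneg _) s) le_rfl)
    filter_upwards [eventually_ge_atTop 1] with r hr
    rw [Finset.sum_apply]
    exact Finset.sum_nonneg fun p _ => nevT_nonneg _ hr
  -- if all orders in `S` lie below `s`, then these data are negligible
  have hneg : ∀ s : ℝ, logOrderOfSet (remainingData A F l a b) < s →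
      limsup (logQuotient (∑ p ∈ P, nevT (A p.1 p.2) + nevT F) s) atTop ≤ 0 := fun s hs => by
    refine (hsplit s).trans (add_nonpos (Finset.sum_nonpos fun p hp => ?_) ?_)
    · exact limsup_logQuotient_le_zero ((hA_le p hp).trans_lt hs)
    · exact limsup_logQuotient_le_zero (hF_le.trans_lt hs)
  obtain ⟨μ, hμ⟩ : ∃ μ : ℝ, logLowerOrder (A l 0) = μ :=
    ⟨_, (EReal.coe_toReal hfin.ne (ne_bot_of_nonneg hpos.le)).symm⟩
  have hμpos : 0 < μ := by rw [hμ] at hpos; exact EReal.coe_pos.1 hpos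
  have hlow := liminf_logQuotient_eq_logLowerType hμ
  rcases hS_le.lt_or_eq with hS | hS
  · rcases hab_le.lt_or_eq with hab | hab
    · obtain ⟨s, hs1, hs2⟩ := EReal.lt_iff_exists_real_btwn.1
        (max_lt (max_lt hx hpos) (max_lt hS hab))
      obtain ⟨hs3, hs4⟩ := max_lt_iff.1 hs1
      obtain ⟨hs5, hs6⟩ := max_lt_iff.1 hs3
      obtain ⟨hs7, hs8⟩ := max_lt_iff.1 hs4
      refine ⟨s, EReal.coe_pos.1 hs6, hs5, ?_⟩
      have h1 := add_le_add (hneg s hs7) (liminf_logQuotient_le_zero hs8)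
      have h2 := one_le_liminf_logQuotient hs2
      rw [add_zero] at h1
      exact (h1.trans_lt zero_lt_one).trans_le h2
    · refine ⟨μ, hμpos, hμ ▸ hx, ?_⟩
      rw [hlow, liminf_logQuotient_eq_logLowerType (hab.trans hμ)]
      refine lt_of_le_of_lt ?_ (h_ii hab.symm)
      have h1 := add_le_add (hneg μ (hμ ▸ hS)) (le_refl (logLowerType (A a b)))
      rwa [zero_add] at h1
  · refine ⟨μ, hμpos, hμ ▸ hx, ?_⟩
    have hFτ : limsup (logQuotient (nevT F) μ) atTop ≤ logType F := by
      rcases (hF_le.trans hS_le).lt_or_eq with h | h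
      · exact (limsup_logQuotient_le_zero (hμ ▸ h)).trans (logType_nonneg F)
      · exact (limsup_logQuotient_eq_logType (h.trans hμ)).le
    have hcrit : ∑ p ∈ P, limsup (logQuotient (nevT (A p.1 p.2)) μ) atTop
        ≤ criticalTypeSum A l a b := by
      have hset : (Finset.univ.filter fun p : Fin (n + 1) × Fin (m + 1) =>
          logOrder (A p.1 p.2) = logLowerOrder (A l 0) ∧ p ≠ (l, 0) ∧ p ≠ (a, b))
          = P.filter fun p => logOrder (A p.1 p.2) = logLowerOrder (A l 0) := by
        ext p
        simp only [hP, Finset.mem_filter, Finset.mem_univ, Finset.mem_erase, true_and, and_true]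
        tauto
      rw [criticalTypeSum, hset, Finset.sum_filter]
      refine Finset.sum_le_sum fun p hp => ?_
      split_ifs with h
      · exact (limsup_logQuotient_eq_logType (h.trans hμ)).le
      · refine limsup_logQuotient_le_zero ?_
        rw [← hμ]
        exact lt_of_le_of_ne ((hA_le p hp).trans hS_le) h
    have hsum := (hsplit μ).trans (add_le_add hcrit hFτ)
    rw [hlow]
    rcases hab_le.lt_or_eq with hab | hab
    · refine lt_of_le_of_lt ?_ (h_iii hS.symm)
      have h1 := add_le_add hsum (liminf_logQuotient_le_zero (hμ ▸ hab))
      rwa [add_zero] at h1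
    · refine lt_of_le_of_lt ?_ (h_iv hab.symm hS.symm)
      rw [liminf_logQuotient_eq_logLowerType (hab.trans hμ)]
      exact add_le_add hsum le_rfl

theorem eventually_const_le_mul_log_rpow {s ε : ℝ} (hs : 0 < s) (hε : 0 < ε) (C : ℝ) :
    ∀ᶠ r in atTop, C ≤ ε * log r ^ s := by
  have h := ((tendsto_rpow_atTop hs).comp tendsto_log_atTop).const_mul_atTop hε
  exact h.eventually_ge_atTop C

/-! ### Poles of the distinguished coefficient, and the final comparison -/

/-- Since `N(r, g) ≤ n(r, g) log r + O(1)`, a pole exponent below `s - 1` makes `N(r, g)` negligible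
in the scale `(log r) ^ s`. -/
theorem eventually_logCounting_le_mul {g : ℂ → ℂ} {s ε : ℝ} (hs : 0 < s) (hε : 0 < ε)
    (h : logPoleExponent g + 1 < s) :
    ∀ᶠ r in atTop, logCounting g ⊤ r ≤ ε * log r ^ s := by
  obtain ⟨y, hy, hys⟩ := EReal.lt_iff_exists_real_btwn.1 h
  rw [EReal.coe_lt_coe_iff] at hys
  have hy' : logPoleExponent g < ((y - 1 : ℝ) : EReal) := by
    rw [EReal.coe_sub]
    exact (EReal.lt_sub_iff_add_lt (Or.inl (EReal.coe_ne_bot 1))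
      (Or.inl (EReal.coe_ne_top 1))).2 hy
  obtain ⟨C, hC⟩ := exists_logCounting_le_mul_log (negPart_nonneg (divisor g univ))
  filter_upwards [eventually_lt_rpow_of_limsup_lt hy', eventually_ge_atTop 1,
    tendsto_log_atTop.eventually_gt_atTop 0, eventually_log_rpow_le_mul hys (half_pos hε),
    eventually_const_le_mul_log_rpow hs (half_pos hε) C] with r h1 h2 h3 h4 h5
  rw [logCounting_top]
  have h6 := hC r h2
  have h7 : (poleCount g r : ℝ) * log r ≤ log r ^ y := by
    calc (poleCount g r : ℝ) * log r ≤ log r ^ (y - 1) * log r := by gcongr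
      _ = log r ^ y := by rw [← rpow_add_one h3.ne', sub_add_cancel]
  have h8 : ((∑ᶠ z ∈ closedBall (0 : ℂ) r, (divisor g univ)⁻ z : ℤ) : ℝ) = poleCount g r := rfl
  rw [h8] at h6
  linarith

theorem tendsto_log_half_rpow_div (s : ℝ) :
    Tendsto (fun R => log (R / 2) ^ s / log R ^ s) atTop (𝓝 1) := by
  have h1 : Tendsto (fun R => 1 - log 2 / log R) atTop (𝓝 1) := by
    simpa using (tendsto_log_atTop.const_div_atTop (log 2)).const_sub 1
  have h2 := h1.rpow_const (p := s) (Or.inl one_ne_zero)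
  rw [one_rpow] at h2
  refine h2.congr' ?_
  filter_upwards [eventually_gt_atTop 2] with R hR
  have hl : 0 < log R := log_pos (by linarith)
  have hl2 : 0 ≤ log (R / 2) := log_nonneg (by linarith)
  rw [← div_rpow hl2 hl.le, log_div (by linarith) two_ne_zero, sub_div, div_self hl.ne']

/-- Halving the radius does not matter in the scale `(log r) ^ s`. -/
theorem not_eventually_half_le {T W : ℝ → ℝ} {s t w : ℝ} (hwt : w < t)
    (hT : ∀ᶠ r in atTop, t * log r ^ s ≤ T r) (hW : ∃ᶠ r in atTop, W r ≤ w * log r ^ s) :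
    ¬ ∀ᶠ R in atTop, T (R / 2) ≤ W R := by
  intro h
  have hlim : Tendsto (fun R => t * (log (R / 2) ^ s / log R ^ s)) atTop (𝓝 t) := by
    simpa using (tendsto_log_half_rpow_div s).const_mul t
  have hhalf : Tendsto (fun R : ℝ => R / 2) atTop atTop := tendsto_id.atTop_div_const two_pos
  obtain ⟨R, hR1, hR2, hR3, hR4, hR5⟩ := (hW.and_eventually (h.and ((hhalf.eventually hT).and
    ((hlim.eventually_const_lt hwt).and (tendsto_log_atTop.eventually_gt_atTop 0))))).exists
  have hpos := rpow_pos_of_pos hR5 s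
  rw [← mul_div_assoc, lt_div_iff₀ hpos] at hR4
  linarith

open Classical in
/-- The dominance of the distinguished coefficient, with real constants `w < t`. -/
theorem exists_eventually_le_frequently_le {n m : ℕ}
    {A : Fin (n + 1) → Fin (m + 1) → ℂ → ℂ} {F : ℂ → ℂ} {l a : Fin (n + 1)} {b : Fin (m + 1)}
    (hab : (a, b) ≠ (l, 0)) {s : ℝ}
    (h : limsup (logQuotient (∑ p ∈ (Finset.univ.erase (l, 0)).erase (a, b), nevT (A p.1 p.2)
        + nevT F) s) atTop + liminf (logQuotient (nevT (A a b)) s) atTop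
      < liminf (logQuotient (nevT (A l 0)) s) atTop) :
    ∃ w t : ℝ, w < t ∧ (∀ᶠ r in atTop, t * log r ^ s ≤ nevT (A l 0) r) ∧
      ∃ᶠ r in atTop, ∑ p ∈ Finset.univ.erase (l, 0), nevT (A p.1 p.2) r + nevT F r
        ≤ w * log r ^ s := by
  obtain ⟨w, hw1, hw2⟩ := EReal.lt_iff_exists_real_btwn.1 h
  obtain ⟨t, ht1, ht2⟩ := EReal.lt_iff_exists_real_btwn.1 hw2
  refine ⟨w, t, EReal.coe_lt_coe_iff.1 ht1, ?_, ?_⟩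
  · filter_upwards [eventually_lt_of_lt_liminf ht2,
      tendsto_log_atTop.eventually_gt_atTop 0] with r h1 h2
    rw [logQuotient, EReal.coe_lt_coe_iff, lt_div_iff₀ (rpow_pos_of_pos h2 s)] at h1
    exact h1.le
  · set Φ : ℝ → ℝ := ∑ p ∈ (Finset.univ.erase (l, 0)).erase (a, b), nevT (A p.1 p.2) + nevT F
      with hΦ
    have hΦ0 : ∀ᶠ r in atTop, 0 ≤ Φ r := by
      filter_upwards [eventually_ge_atTop 1] with r hr
      rw [hΦ, Pi.add_apply, Finset.sum_apply]
      exact add_nonneg (Finset.sum_nonneg fun p _ => nevT_nonneg _ hr) (nevT_nonneg _ hr)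
    have h1 : liminf (logQuotient (Φ + nevT (A a b)) s) atTop < w := by
      rw [logQuotient_add]
      refine (EReal.liminf_add_le ?_ ?_).trans_lt hw1
      · exact Or.inl (ne_bot_of_nonneg (limsup_logQuotient_nonneg hΦ0 s))
      · exact Or.inr (ne_bot_of_nonneg (liminf_logQuotient_nonneg (eventually_nevT_nonneg _) s))
    refine ((frequently_lt_of_liminf_lt (by isBoundedDefault) h1).and_eventually
      (tendsto_log_atTop.eventually_gt_atTop 0)).mono fun r hr => ?_
    obtain ⟨h2, h3⟩ := hr
    rw [logQuotient, EReal.coe_lt_coe_iff, div_lt_iff₀ (rpow_pos_of_pos h3 s)] at h2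
    have hmem : (a, b) ∈ (Finset.univ.erase (l, 0) : Finset (Fin (n + 1) × Fin (m + 1))) := by
      simpa using hab
    rw [← Finset.add_sum_erase _ _ hmem]
    simp only [hΦ, Pi.add_apply, Finset.sum_apply] at h2
    linarith

/-- The zero function solves only the homogeneous equation. -/
theorem not_merEq_zero_of_isMeromorphicSolution {n m : ℕ}
    {A : Fin (n + 1) → Fin (m + 1) → ℂ → ℂ} {F f : ℂ → ℂ} {c : Fin (n + 1) → ℂ}
    (hsol : IsMeromorphicSolution A c F f) (hF : ¬ MerEq F 0) : ¬ MerEq f 0 := by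
  intro h0
  refine hF ?_
  have h1 : ∀ᶠ z in codiscrete ℂ, ∀ p : Fin (n + 1) × Fin (m + 1),
      iteratedDeriv (p.2 : ℕ) f (z + c p.1) = iteratedDeriv (p.2 : ℕ) (0 : ℂ → ℂ) (z + c p.1) :=
    eventually_all.2 fun p => h0.iteratedDeriv_comp_add p.2 (c p.1)
  change ∀ᶠ z in codiscrete ℂ, F z = (0 : ℂ → ℂ) z
  filter_upwards [h1, hsol.2] with z h1 h2
  rw [← h2]
  refine Finset.sum_eq_zero fun i _ => Finset.sum_eq_zero fun j _ => ?_
  rw [h1 (i, j)]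
  have : (0 : ℂ → ℂ) = fun _ => 0 := rfl
  rw [this, iteratedDeriv_const]
  simp

end DelayDiff

open Filter DelayDiff

theorem theorem1p1 (n m : ℕ) (A : Fin (n + 1) → Fin (m + 1) → ℂ → ℂ) (F : ℂ → ℂ)
    (c : Fin (n + 1) → ℂ) (l a : Fin (n + 1)) (b : Fin (m + 1))
    (hA : ∀ i j, Meromorphic (A i j)) (hF : Meromorphic F)
    (hc_inj : Function.Injective c) (hc_ne : ∀ i, c i ≠ 0)
    (hab : (a, b) ≠ (l, 0))
    (hpos : 0 < DelayDiff.logLowerOrder (A l 0))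
    (hpole : DelayDiff.logPoleExponent (A l 0) + 1 < DelayDiff.logLowerOrder (A l 0))
    (hfin : DelayDiff.logLowerOrder (A l 0) < ⊤)
    (h_i : max (DelayDiff.logLowerOrder (A a b))
        (DelayDiff.logOrderOfSet (DelayDiff.remainingData A F l a b)) ≤
      DelayDiff.logLowerOrder (A l 0))
    (h_ii : DelayDiff.logLowerOrder (A l 0) = DelayDiff.logLowerOrder (A a b) →
      DelayDiff.logLowerType (A a b) < DelayDiff.logLowerType (A l 0))
    (h_iii : DelayDiff.logLowerOrder (A l 0) =
        DelayDiff.logOrderOfSet (DelayDiff.remainingData A F l a b) →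
      DelayDiff.criticalTypeSum A l a b + DelayDiff.logType F <
          DelayDiff.logLowerType (A l 0) ∧
        DelayDiff.logLowerType (A l 0) < ⊤)
    (h_iv : DelayDiff.logLowerOrder (A l 0) = DelayDiff.logLowerOrder (A a b) →
      DelayDiff.logLowerOrder (A l 0) =
        DelayDiff.logOrderOfSet (DelayDiff.remainingData A F l a b) →
      DelayDiff.criticalTypeSum A l a b + DelayDiff.logType F + DelayDiff.logLowerType (A a b) <
          DelayDiff.logLowerType (A l 0) ∧
        DelayDiff.logLowerType (A l 0) < ⊤) :
    (¬ DelayDiff.MerEq F 0 →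
      ∀ f : ℂ → ℂ, DelayDiff.IsMeromorphicSolution A c F f →
        DelayDiff.logLowerOrder (A l 0) ≤ DelayDiff.logOrder f) ∧
    (DelayDiff.MerEq F 0 →
      ∀ f : ℂ → ℂ, DelayDiff.IsMeromorphicSolution A c 0 f → ¬ DelayDiff.MerEq f 0 →
        DelayDiff.logLowerOrder (A l 0) + 1 ≤ DelayDiff.logOrder f) := by
  have hdom {x : EReal} (hx : x < logLowerOrder (A l 0)) :=
    exists_exponent_limsup_add_liminf_lt hpos hfin h_i h_ii (fun h => (h_iii h).1)
      (fun h h' => (h_iv h h').1) hx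
  refine ⟨fun hF0 f hsol => ?_, fun _ f hsol hf0 => ?_⟩
  · by_contra! hlt
    -- the exponent exceeds both `logPoleExponent (A l 0) + 1` and `logOrder f`
    obtain ⟨s, hs, hxs, hs'⟩ := hdom (max_lt hpole hlt)
    obtain ⟨hpole', hf'⟩ := max_lt_iff.1 hxs
    obtain ⟨w, t, hwt, ht, hw⟩ := exists_eventually_le_frequently_le hab hs'
    obtain ⟨K, hK⟩ := exists_eventually_nevT_le_log_pow (hlt.trans hfin)
    obtain ⟨C, hC⟩ := exists_eventually_nevT_half_le l hA hF hsol
      (not_merEq_zero_of_isMeromorphicSolution hsol hF0) hK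
    have hε : 0 < (t - w) / 4 := by linarith
    obtain ⟨y, hy, hys⟩ := EReal.lt_iff_exists_real_btwn.1 hf'
    refine not_eventually_half_le (w := w + 3 * ((t - w) / 4)) (by linarith) ht ?_ hC
    refine (hw.and_eventually ((eventually_logCounting_le_mul hs hε hpole').and
      ((eventually_lt_rpow_of_limsup_lt hy).and
      ((eventually_log_rpow_le_mul (EReal.coe_lt_coe_iff.1 hys) hε).and
      (eventually_const_le_mul_log_rpow hs hε C))))).mono fun r hr => ?_
    obtain ⟨h1, h2, h3, h4, h5⟩ := hr
    linarith
  · -- a solution of finite logarithmic order is already impossible here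
    by_contra! hlt
    obtain ⟨s, hs, hpole', hs'⟩ := hdom hpole
    obtain ⟨w, t, hwt, ht, hw⟩ := exists_eventually_le_frequently_le hab hs'
    obtain ⟨K, hK⟩ := exists_eventually_nevT_le_log_pow (hlt.trans_le le_top)
    obtain ⟨C, hC⟩ := exists_eventually_nevT_half_le_of_homogeneous l hA hsol hf0 hK
    have hε : 0 < (t - w) / 4 := by linarith
    refine not_eventually_half_le (w := w + 2 * ((t - w) / 4)) (by linarith) ht ?_ hC
    refine (hw.and_eventually ((eventually_logCounting_le_mul hs hε hpole').and
      ((eventually_nevT_nonneg F).and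
      (eventually_const_le_mul_log_rpow hs hε C)))).mono fun r hr => ?_
    obtain ⟨h1, h2, h3, h4⟩ := hr
    linarith
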